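/- \textbf{Conventions.} A continuous map $f\colon Y\to X$ of topological spaces is \emph{proper} if it is universally closed (i.e. $f\times\mathrm{id}\colon Y\times T\to X\times T$ is closed for every topological space $T$), and \emph{separated} if the diagonal is closed in $Y\times_X Y$. It is \emph{locally proper} if for every $y\in Y$ and every neighbourhood $V$ of $y$ there are neighbourhoods $A\subset V$ of $y$ and $U$ of $f(y)$ with $f(A)\subset U$ such that the induced map $A\to U$ is proper. Let $\operatorname{Sh}(X)$ be the category of sheaves of abelian groups on $X$ and $D^+(X)$ the full triangulated subcategory of its derived category consisting of the complexes with bounded below cohomology sheaves. The \emph{proper direct image} $f_{(!)}\colon\operatorname{Sh}(Y)\to\operatorname{Sh}(X)$ is the subfunctor of the direct image $f_{(*)}$ given by $$(f_{(!)}\mathcal F)(U)=\{s\in\mathcal F(f^{-1}(U)) \mid f\colon \operatorname{supp}(s)\to U \text{ is proper}\}\qquad (U\subset X\text{ open}),$$ and $f_!=\mathrm R f_{(!)}\colon D^+(Y)\to D^+(X)$ denotes its right derived functor. If $f\colon Y\to X$ is separated and $g\colon Z\to Y$ is continuous, then the identity $f_{(*)}\circ g_{(*)}=(f\circ g)_{(*)}$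 restricts to an identity $f_{(!)}\circ g_{(!)}=(f\circ g)_{(!)}$. \textbf{Theorem (Iterated derived proper images).} Let $g\colon Z\to Y$ and $f\colon Y\to X$ be separated locally proper maps of topological spaces. Then the morphism of right derived functors induced by the identity $f_{(!)}\circ g_{(!)}=(f\circ g)_{(!)}$ is an isomorphism $$(f\circ g)_!\ \xrightarrow{\ \sim\ }\ f_!\circ g_!$$ of triangulated functors $D^+(Z)\to D^+(X)$. -/

import Mathlib

open CategoryTheory TopologicalSpace Opposite Topology

universe u w₁ w₂ w₃

/-- A map of topological spaces is locally proper if it is continuous and if for every point `y`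
and every neighbourhood `V` of `y` there are neighbourhoods `A ⊆ V` of `y` and `U` of `f y` with
`f(A) ⊆ U` such that the induced map `A → U` is proper. -/
def IsLocallyProper {Y X : Type*} [TopologicalSpace Y] [TopologicalSpace X] (f : Y → X) : Prop :=
  Continuous f ∧ ∀ (y : Y), ∀ V ∈ 𝓝 y, ∃ A ∈ 𝓝 y, ∃ U ∈ 𝓝 (f y),
    A ⊆ V ∧ ∃ h : Set.MapsTo f A U, IsProperMap (h.restrict f A U)

/-- The category `Sh(X)` of sheaves of abelian groups on `X`. -/
abbrev Sh (X : TopCat.{u}) := TopCat.Sheaf AddCommGrpCat.{u} X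

namespace Sh

variable {X Y Z : TopCat.{u}}

/-- The support of a section `s` of a sheaf over an open subset `V`: the points of `V` at which
the germ of `s` is nonzero. -/
def supp (F : Sh Y) {V : Opens Y} (s : F.presheaf.obj (op V)) : Set Y :=
  {y | ∃ h : y ∈ V, F.presheaf.germ V y h s ≠ 0}

lemma supp_subset (F : Sh Y) {V : Opens Y} (s : F.presheaf.obj (op V)) :
    supp F s ⊆ V := fun _ h ↦ h.1

lemma notMem_supp_iff (F : Sh Y) {V : Opens Y} (s : F.presheaf.obj (op V)) (y : Y) (hy : y ∈ V) :
    y ∉ supp F s ↔ ∃ W : Opens Y, y ∈ W ∧ ∃ i : W ⟶ V, F.presheaf.map i.op s = 0 := by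
  simp only [supp, Set.mem_ofPred_eq, not_exists, not_not, ne_eq]
  constructor
  · intro h
    have h0 : F.presheaf.germ V y hy s = F.presheaf.germ V y hy 0 := by rw [h hy, map_zero]
    obtain ⟨W, hW, i, j, e⟩ := F.presheaf.germ_eq y hy hy s 0 h0
    exact ⟨W, hW, i, by rw [e, map_zero]⟩
  · rintro ⟨W, hW, i, e⟩ _
    rw [← F.presheaf.germ_res_apply i y hW s, e, map_zero]

lemma mem_of_supp_mem (F : Sh Y) {V : Opens Y} (s : F.presheaf.obj (op V))
    (𝒰 : Ultrafilter Y) (h : supp F s ∈ 𝒰) (y : Y) (hy : y ∈ V) (hle : ↑𝒰 ≤ 𝓝 y) :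
    y ∈ supp F s := by
  by_contra hn
  obtain ⟨W, hW, i, e⟩ := (notMem_supp_iff F s y hy).1 hn
  have hW' : (W : Set Y) ∈ 𝒰 := hle (W.isOpen.mem_nhds hW)
  obtain ⟨z, hz, hzW⟩ := 𝒰.nonempty_of_mem (Filter.inter_mem h hW')
  exact (notMem_supp_iff F s z hz.1).2 ⟨W, hzW, i, e⟩ hz

lemma supp_zero (F : Sh Y) (V : Opens Y) : supp F (0 : F.presheaf.obj (op V)) = ∅ := by
  ext y; simp [supp]

lemma supp_add (F : Sh Y) {V : Opens Y} (s t : F.presheaf.obj (op V)) :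
    supp F (s + t) ⊆ supp F s ∪ supp F t := by
  rintro y ⟨hy, h⟩
  by_contra hn
  simp only [supp, Set.mem_union, Set.mem_ofPred_eq, not_or, not_exists, not_not, ne_eq] at hn
  exact h (by rw [map_add, hn.1 hy, hn.2 hy, add_zero])

lemma supp_neg (F : Sh Y) {V : Opens Y} (s : F.presheaf.obj (op V)) :
    supp F (-s) = supp F s := by
  ext y; simp [supp]

lemma supp_map (F : Sh Y) {V W : Opens Y} (i : W ⟶ V) (s : F.presheaf.obj (op V)) :
    supp F (F.presheaf.map i.op s) = supp F s ∩ W := by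
  ext y
  constructor
  · rintro ⟨hy, h⟩
    exact ⟨⟨i.le hy, by rwa [F.presheaf.germ_res_apply] at h⟩, hy⟩
  · rintro ⟨⟨hV, h⟩, hy⟩
    exact ⟨hy, by rwa [F.presheaf.germ_res_apply]⟩

lemma supp_app {F G : Sh Y} (φ : F ⟶ G) {V : Opens Y} (s : F.presheaf.obj (op V)) :
    supp G (φ.1.app (op V) s) ⊆ supp F s := by
  rintro y ⟨hy, h⟩
  refine ⟨hy, fun h0 ↦ h ?_⟩
  rw [← TopCat.Presheaf.stalkFunctor_map_germ_apply, h0]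
  exact map_zero (ConcreteCategory.hom
    ((TopCat.Presheaf.stalkFunctor AddCommGrpCat.{u} y).map φ.1))

/-- For an open subset `U` of `X`, a section `s ∈ F(f⁻¹(U))` has proper support over `U` if the
map `supp s → U` induced by `f` is proper. -/
def HasProperSupport (f : Y ⟶ X) (F : Sh Y) (U : Opens X)
    (s : F.presheaf.obj (op ((Opens.map f).obj U))) : Prop :=
  IsProperMap (fun y : supp F s ↦ (⟨f y, y.2.1⟩ : U))

lemma hasProperSupport_iff (f : Y ⟶ X) (F : Sh Y) (U : Opens X)
    (s : F.presheaf.obj (op ((Opens.map f).obj U))) :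
    HasProperSupport f F U s ↔ ∀ 𝒰 : Ultrafilter Y, supp F s ∈ 𝒰 → ∀ x ∈ U,
      Filter.Tendsto f 𝒰 (𝓝 x) → ∃ y ∈ (Opens.map f).obj U, f y = x ∧ ↑𝒰 ≤ 𝓝 y := by
  unfold HasProperSupport
  rw [isProperMap_iff_ultrafilter]
  constructor
  · rintro ⟨-, h⟩ 𝒰 hs x hx ht
    have hr : Set.range (Subtype.val : supp F s → Y) ∈ 𝒰 := by simpa using! hs
    let 𝒱 : Ultrafilter (supp F s) := 𝒰.comap Subtype.val_injective hr
    have hmap : Filter.map Subtype.val (𝒱 : Filter (supp F s)) = 𝒰 := by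
      rw [Ultrafilter.coe_comap]; exact Filter.map_comap_of_mem hr
    obtain ⟨y, hy, hle⟩ := @h 𝒱 ⟨x, hx⟩ (by
      rw [tendsto_subtype_rng]
      change Filter.Tendsto (f ∘ Subtype.val) (𝒱 : Filter (supp F s)) (𝓝 x)
      rw [← Filter.tendsto_map'_iff, hmap]
      exact ht)
    refine ⟨y, y.2.1, congrArg Subtype.val hy, ?_⟩
    rw [← hmap]
    exact (Filter.map_mono hle).trans continuous_subtype_val.continuousAt
  · intro h
    refine ⟨by fun_prop, fun 𝒱 x ht ↦ ?_⟩
    have hs : supp F s ∈ 𝒱.map Subtype.val := by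
      rw [Ultrafilter.mem_map]
      exact Filter.univ_mem' fun y ↦ y.2
    rw [tendsto_subtype_rng] at ht
    obtain ⟨y, hyU, hy, hle⟩ := h (𝒱.map Subtype.val) hs x x.2 (by
      rw [Ultrafilter.coe_map, Filter.tendsto_map'_iff]; exact ht)
    refine ⟨⟨y, mem_of_supp_mem F s _ hs y hyU hle⟩, Subtype.ext hy, ?_⟩
    rw [nhds_subtype, ← Filter.map_le_iff_le_comap]
    exact hle

/-- The group `(f_(!) F)(U)` of the sections `s ∈ F(f⁻¹(U))` with proper support over `U`. -/
def properSections (f : Y ⟶ X) (F : Sh Y) (U : Opens X) :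
    AddSubgroup (F.presheaf.obj (op ((Opens.map f).obj U))) where
  carrier := {s | HasProperSupport f F U s}
  zero_mem' := by
    rw [Set.mem_ofPred_eq, hasProperSupport_iff]
    intro 𝒰 h
    rw [supp_zero] at h
    exact (𝒰.empty_notMem h).elim
  add_mem' {s t} hs ht := by
    rw [Set.mem_ofPred_eq, hasProperSupport_iff] at *
    intro 𝒰 h x hx hf
    rcases Ultrafilter.union_mem_iff.1 (Filter.mem_of_superset h (supp_add F s t)) with h | h
    · exact hs 𝒰 h x hx hf
    · exact ht 𝒰 h x hx hf
  neg_mem' {s} hs := by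
    rw [Set.mem_ofPred_eq, hasProperSupport_iff] at *
    rwa [supp_neg]

lemma mem_properSections (f : Y ⟶ X) (F : Sh Y) (U : Opens X)
    (s : F.presheaf.obj (op ((Opens.map f).obj U))) :
    s ∈ properSections f F U ↔ HasProperSupport f F U s := Iff.rfl

lemma map_mem_properSections (f : Y ⟶ X) (F : Sh Y) {U V : Opens X} (i : V ⟶ U)
    {s : F.presheaf.obj (op ((Opens.map f).obj U))} (hs : s ∈ properSections f F U) :
    F.presheaf.map ((Opens.map f).map i).op s ∈ properSections f F V := by
  rw [mem_properSections, hasProperSupport_iff] at *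
  intro 𝒰 h x hx hf
  rw [supp_map] at h
  obtain ⟨y, -, rfl, hle⟩ := hs 𝒰 (Filter.mem_of_superset h Set.inter_subset_left) x (i.le hx) hf
  exact ⟨y, hx, rfl, hle⟩

lemma app_mem_properSections (f : Y ⟶ X) {F G : Sh Y} (φ : F ⟶ G) (U : Opens X)
    {s : F.presheaf.obj (op ((Opens.map f).obj U))} (hs : s ∈ properSections f F U) :
    φ.1.app _ s ∈ properSections f G U := by
  rw [mem_properSections, hasProperSupport_iff] at *
  exact fun 𝒰 h ↦ hs 𝒰 (Filter.mem_of_superset h (supp_app φ s))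

lemma mem_properSections_of_cover (f : Y ⟶ X) (F : Sh Y) {ι : Type*} {U : Opens X}
    (V : ι → Opens X) (i : ∀ k, V k ⟶ U) (hV : U ≤ iSup V)
    {s : F.presheaf.obj (op ((Opens.map f).obj U))}
    (hs : ∀ k, F.presheaf.map ((Opens.map f).map (i k)).op s ∈ properSections f F (V k)) :
    s ∈ properSections f F U := by
  rw [mem_properSections, hasProperSupport_iff]
  intro 𝒰 h x hx hf
  obtain ⟨k, hk⟩ := Opens.mem_iSup.1 (hV hx)
  have h1 := (hasProperSupport_iff f F _ _).1 (hs k)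
  have h2 : f ⁻¹' (V k) ∈ (𝒰 : Filter Y) := hf ((V k).isOpen.mem_nhds hk)
  obtain ⟨y, hy, hyx, hle⟩ := h1 𝒰 (by rw [supp_map]; exact Filter.inter_mem h h2) x hk hf
  exact ⟨y, ((Opens.map f).map (i k)).le hy, hyx, hle⟩

/-- The presheaf `U ↦ (f_(!) F)(U)`, a subpresheaf of the direct image `f_(*) F`. -/
def properDirectImagePresheaf (f : Y ⟶ X) (F : Sh Y) : TopCat.Presheaf AddCommGrpCat.{u} X where
  obj U := AddCommGrpCat.of (properSections f F U.unop)
  map {U V} i := AddCommGrpCat.ofHom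
    (((F.presheaf.map ((Opens.map f).map i.unop).op).hom.comp
      (properSections f F U.unop).subtype).codRestrict (properSections f F V.unop)
        fun s ↦ map_mem_properSections f F i.unop s.2)
  map_id U := by
    ext s
    exact ConcreteCategory.congr_hom (F.presheaf.map_id _) s.1
  map_comp i j := by
    ext s
    exact ConcreteCategory.congr_hom
      (F.presheaf.map_comp ((Opens.map f).map i.unop).op ((Opens.map f).map j.unop).op) s.1

lemma properDirectImagePresheaf_isSheaf (f : Y ⟶ X) (F : Sh Y) :
    (properDirectImagePresheaf f F).IsSheaf := by
  rw [TopCat.Presheaf.isSheaf_iff_isSheafUniqueGluing]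
  intro ι U sf hsf
  obtain ⟨s, hs, huniq⟩ := ((TopCat.Sheaf.pushforward AddCommGrpCat.{u} f).obj F).existsUnique_gluing
    U (fun i ↦ (sf i).1) (fun i j ↦ congrArg Subtype.val (hsf i j))
  refine ⟨⟨s, mem_properSections_of_cover f F U (Opens.leSupr U) le_rfl fun k ↦ ?_⟩, fun k ↦ ?_,
    fun t ht ↦ ?_⟩
  · have := hs k
    exact this ▸ (sf k).2
  · exact Subtype.ext (hs k)
  · exact Subtype.ext (huniq t.1 fun k ↦ congrArg Subtype.val (ht k))

/-- The proper direct image functor `f_(!) : Sh(Y) ⥤ Sh(X)`. -/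
def properDirectImage (f : Y ⟶ X) : Sh Y ⥤ Sh X where
  obj F := ⟨properDirectImagePresheaf f F, properDirectImagePresheaf_isSheaf f F⟩
  map {F G} φ := ⟨{
    app U := AddCommGrpCat.ofHom
      (((φ.1.app (op ((Opens.map f).obj U.unop))).hom.comp
        (properSections f F U.unop).subtype).codRestrict (properSections f G U.unop)
          fun s ↦ app_mem_properSections f φ U.unop s.2)
    naturality U V i := by
      ext s
      exact Subtype.ext (ConcreteCategory.congr_hom
        (φ.1.naturality ((Opens.map f).map i.unop).op) s.1) }⟩
  map_id F := rfl
  map_comp φ ψ := rfl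

/-- The inclusion of `f_(!)` into the direct image functor `f_(*)`. -/
def properDirectImageι (f : Y ⟶ X) :
    properDirectImage f ⟶ TopCat.Sheaf.pushforward AddCommGrpCat.{u} f where
  app F := ⟨{ app U := AddCommGrpCat.ofHom (properSections f F U.unop).subtype }⟩

instance properDirectImage_additive (f : Y ⟶ X) : (properDirectImage f).Additive where
  map_add := rfl


lemma exists_of_mem_nhds (F : Sh Y) {V W : Opens Y} (i : W ⟶ V) (s : F.presheaf.obj (op V))
    (h : F.presheaf.map i.op s ≠ 0) : ∃ y ∈ W, y ∈ supp F s := by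
  by_contra! hn
  refine h (TopCat.Presheaf.section_ext F W _ 0 fun y hy ↦ ?_)
  by_contra hne
  rw [map_zero] at hne
  have : y ∈ supp F (F.presheaf.map i.op s) := ⟨hy, hne⟩
  rw [supp_map] at this
  exact hn y hy this.1

lemma notMem_supp_properDirectImage (g : Z ⟶ Y) (F : Sh Z) {V : Opens Y}
    (s : properSections g F V) (y : Y) (hy : y ∈ V) :
    y ∉ supp ((properDirectImage g).obj F) (V := V) s ↔ ∃ W : Opens Y, y ∈ W ∧ ∃ i : W ⟶ V,
      F.presheaf.map ((Opens.map g).map i).op s.1 = 0 := by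
  refine (notMem_supp_iff ((properDirectImage g).obj F) (V := V) s y hy).trans ?_
  exact exists_congr fun W ↦ and_congr_right fun _ ↦ exists_congr fun i ↦
    ⟨fun h ↦ congrArg Subtype.val h, fun h ↦ Subtype.ext h⟩

lemma supp_properDirectImage (g : Z ⟶ Y) (F : Sh Z) {V : Opens Y} (s : properSections g F V) :
    supp ((properDirectImage g).obj F) (V := V) s = g '' supp F s.1 := by
  ext y
  constructor
  · intro hy
    have hyV : y ∈ V := hy.1
    have hne : (Filter.comap g (𝓝 y) ⊓ Filter.principal (supp F s.1)).NeBot := by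
      rw [Filter.inf_principal_neBot_iff]
      rintro T ⟨N, hN, hT⟩
      obtain ⟨W, hWN, hW, hyW⟩ := mem_nhds_iff.1 hN
      by_contra hempty
      refine (notMem_supp_properDirectImage g F s y hyV).2 ⟨⟨W, hW⟩ ⊓ V, ⟨hyW, hyV⟩,
        homOfLE inf_le_right, ?_⟩ hy
      by_contra hne
      obtain ⟨z, hz, hzs⟩ := exists_of_mem_nhds F _ s.1 hne
      exact hempty ⟨z, hT (hWN hz.1), hzs⟩
    let 𝒱 := Ultrafilter.of (Filter.comap g (𝓝 y) ⊓ Filter.principal (supp F s.1))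
    have h𝒱 := Ultrafilter.of_le (Filter.comap g (𝓝 y) ⊓ Filter.principal (supp F s.1))
    have hs𝒱 : supp F s.1 ∈ 𝒱 := Filter.le_principal_iff.1 (h𝒱.trans inf_le_right)
    obtain ⟨z, hz, hzy, hle⟩ := (hasProperSupport_iff g F V s.1).1 s.2 𝒱 hs𝒱 y hyV
      (Filter.tendsto_iff_comap.2 (h𝒱.trans inf_le_left))
    exact ⟨z, mem_of_supp_mem F _ 𝒱 hs𝒱 z hz hle, hzy⟩
  · rintro ⟨z, hz, rfl⟩
    by_contra hn
    obtain ⟨W, hW, i, h0⟩ := (notMem_supp_properDirectImage g F s (g z) hz.1).1 hn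
    exact (notMem_supp_iff F s.1 z hz.1).2 ⟨(Opens.map g).obj W, hW, (Opens.map g).map i, h0⟩ hz

lemma mem_properSections_comp_of_mem (g : Z ⟶ Y) (f : Y ⟶ X) (F : Sh Z) (U : Opens X)
    (s : properSections g F ((Opens.map f).obj U))
    (h : s ∈ properSections f ((properDirectImage g).obj F) U) :
    s.1 ∈ properSections (g ≫ f) F U := by
  refine (hasProperSupport_iff (g ≫ f) F U s.1).2 fun 𝒱 h𝒱 x hx hlim ↦ ?_
  obtain ⟨y, hy, hyx, hle⟩ := (hasProperSupport_iff f _ U _).1 h (𝒱.map g) (by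
    rw [supp_properDirectImage]
    exact Filter.image_mem_map h𝒱) x hx (by
      rw [Ultrafilter.coe_map, Filter.tendsto_map'_iff]; exact hlim)
  obtain ⟨z, hz, hzy, hle'⟩ := (hasProperSupport_iff g F _ s.1).1 s.2 𝒱 h𝒱 y hy hle
  exact ⟨z, hz, (congrArg f hzy).trans hyx, hle'⟩

lemma mem_properSections_left (g : Z ⟶ Y) (f : Y ⟶ X) (hf : IsSeparatedMap f) (F : Sh Z)
    (U : Opens X) (s : F.presheaf.obj (op ((Opens.map (g ≫ f)).obj U)))
    (h : s ∈ properSections (g ≫ f) F U) :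
    s ∈ properSections g F ((Opens.map f).obj U) := by
  refine (hasProperSupport_iff g F ((Opens.map f).obj U) s).2 fun 𝒱 h𝒱 y hy hlim ↦ ?_
  obtain ⟨z, hz, hzy, hle⟩ := (hasProperSupport_iff (g ≫ f) F U s).1 h 𝒱 h𝒱 (f y) hy
    ((f.hom.continuous.tendsto y).comp hlim)
  refine ⟨z, hz, ?_, hle⟩
  by_contra hne
  have hd := isSeparatedMap_iff_disjoint_nhds.1 hf (g z) y hzy hne
  exact hlim.not_tendsto hd.symm ((g.hom.continuous.tendsto z).mono_left hle)

lemma mem_properSections_right (g : Z ⟶ Y) (f : Y ⟶ X) (hf : IsSeparatedMap f) (F : Sh Z)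
    (U : Opens X) (s : F.presheaf.obj (op ((Opens.map (g ≫ f)).obj U)))
    (h : s ∈ properSections (g ≫ f) F U) :
    (⟨s, mem_properSections_left g f hf F U s h⟩ : properSections g F ((Opens.map f).obj U)) ∈
      properSections f ((properDirectImage g).obj F) U := by
  refine (hasProperSupport_iff f _ U _).2 fun 𝒰 h𝒰 x hx hlim ↦ ?_
  rw [supp_properDirectImage] at h𝒰
  have hmap : (𝒰 : Filter Y) = (Ultrafilter.ofComapInfPrincipal h𝒰).map g :=
    congrArg _ (Ultrafilter.ofComapInfPrincipal_eq_of_map h𝒰).symm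
  obtain ⟨z, hz, hzx, hle⟩ := (hasProperSupport_iff (g ≫ f) F U s).1 h
    (Ultrafilter.ofComapInfPrincipal h𝒰) (Ultrafilter.ofComapInfPrincipal_mem h𝒰) x hx (by
      rw [hmap, Ultrafilter.coe_map, Filter.tendsto_map'_iff] at hlim
      exact hlim)
  refine ⟨g z, hz, hzx, ?_⟩
  rw [hmap]
  exact (Filter.map_mono hle).trans (g.hom.continuous.tendsto z)

/-- The identity `f_(!) ∘ g_(!) = (f ∘ g)_(!)` for separated `f`: both sides consist of the same
sections of `F` over the open subsets `g⁻¹(f⁻¹(U))`, and the isomorphism does not change them. -/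
def properDirectImageComp (g : Z ⟶ Y) (f : Y ⟶ X) (hf : IsSeparatedMap f) :
    properDirectImage g ⋙ properDirectImage f ≅ properDirectImage (g ≫ f) where
  hom := {
    app F := ⟨{
      app U := AddCommGrpCat.ofHom
        { toFun s := ⟨s.1.1, mem_properSections_comp_of_mem g f F U.unop s.1 s.2⟩
          map_zero' := rfl
          map_add' _ _ := rfl } }⟩ }
  inv := {
    app F := ⟨{
      app U := AddCommGrpCat.ofHom
        { toFun s := ⟨⟨s.1, mem_properSections_left g f hf F U.unop s.1 s.2⟩,
            mem_properSections_right g f hf F U.unop s.1 s.2⟩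
          map_zero' := rfl
          map_add' _ _ := rfl } }⟩ }
  hom_inv_id := rfl
  inv_hom_id := rfl

lemma properDirectImageComp_hom_comp_ι (g : Z ⟶ Y) (f : Y ⟶ X) (hf : IsSeparatedMap f) :
    (properDirectImageComp g f hf).hom ≫ properDirectImageι (g ≫ f) =
      Functor.whiskerRight (properDirectImageι g) (properDirectImage f) ≫
        Functor.whiskerLeft (TopCat.Sheaf.pushforward AddCommGrpCat.{u} g)
          (properDirectImageι f) :=
  rfl

end Sh

namespace DerivedPlus

variable {A B C : Type*} [Category* A] [Category* B] [Category* C] [Abelian A] [Abelian B]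
  [Abelian C] [HasDerivedCategory A] [HasDerivedCategory B] [HasDerivedCategory C]

section

variable (A)

/-- The functor `K⁺(injectives of A) ⥤ D⁺(A)`. -/
noncomputable abbrev injectiveToDerived :
    HomotopyCategory.Plus (InjectiveObject A) ⥤ DerivedCategory.Plus A :=
  (InjectiveObject.ι A).mapHomotopyCategoryPlus ⋙ DerivedCategory.Plus.Qh

lemma Qh_map_bijective (K : HomotopyCategory.Plus A)
    (L : HomotopyCategory.Plus (InjectiveObject A)) : Function.Bijective
    (DerivedCategory.Plus.Qh.map :
      (K ⟶ (InjectiveObject.ι A).mapHomotopyCategoryPlus.obj L) → _) := by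
  obtain ⟨L, rfl⟩ := HomotopyCategory.Plus.quotient_obj_surjective L
  exact DerivedCategory.Plus.Qh_map_bijective_of_isKInjective _ _
    (inferInstanceAs (CochainComplex.IsKInjective
      (((InjectiveObject.ι A).mapHomologicalComplex (.up ℤ)).obj L.obj)))

instance full_injectiveToDerived : (injectiveToDerived A).Full where
  map_surjective {K L} f := by
    obtain ⟨g, rfl⟩ := (Qh_map_bijective A
      ((InjectiveObject.ι A).mapHomotopyCategoryPlus.obj K) L).2 f
    obtain ⟨h, rfl⟩ := (InjectiveObject.ι A).mapHomotopyCategoryPlus.map_surjective g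
    exact ⟨h, rfl⟩

instance faithful_injectiveToDerived : (injectiveToDerived A).Faithful where
  map_injective {K L} _ _ h :=
    (InjectiveObject.ι A).mapHomotopyCategoryPlus.map_injective
      ((Qh_map_bijective A ((InjectiveObject.ι A).mapHomotopyCategoryPlus.obj K) L).1 h)

instance isEquivalence_injectiveToDerived [EnoughInjectives A] :
    (injectiveToDerived A).IsEquivalence where

instance isLocalization_injectiveToDerived [EnoughInjectives A] :
    (injectiveToDerived A).IsLocalization (MorphismProperty.isomorphisms _) :=
  Functor.IsLocalization.of_isEquivalence _ _ le_rfl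

end

variable [EnoughInjectives A] (F : A ⥤ B) [F.Additive]

/-- On bounded below complexes of injectives the unit of `RF` is an isomorphism. -/
noncomputable def injectiveIso :
    injectiveToDerived A ⋙ F.rightDerivedFunctorPlus ≅
      (InjectiveObject.ι A).mapHomotopyCategoryPlus ⋙
        F.mapHomotopyCategoryPlus ⋙ DerivedCategory.Plus.Qh :=
  (NatIso.ofComponents (fun K ↦ asIso (F.rightDerivedFunctorPlusUnit.app
    ((InjectiveObject.ι A).mapHomotopyCategoryPlus.obj K)))
    fun _ ↦ F.rightDerivedFunctorPlusUnit.naturality _).symm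

/-- The commutation with shifts of `RF : D⁺(A) ⥤ D⁺(B)`; it is characterized by the fact that the
unit of the right derived functor commutes with shifts, see `commShift_unit` below. -/
noncomputable instance commShiftRightDerived : F.rightDerivedFunctorPlus.CommShift ℤ :=
  letI : Localization.Lifting (injectiveToDerived A) (MorphismProperty.isomorphisms _)
    ((InjectiveObject.ι A).mapHomotopyCategoryPlus ⋙
        F.mapHomotopyCategoryPlus ⋙ DerivedCategory.Plus.Qh) F.rightDerivedFunctorPlus :=
    ⟨injectiveIso F⟩
  Functor.commShiftOfLocalization (injectiveToDerived A) (MorphismProperty.isomorphisms _) ℤ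
    ((InjectiveObject.ι A).mapHomotopyCategoryPlus ⋙
        F.mapHomotopyCategoryPlus ⋙ DerivedCategory.Plus.Qh) F.rightDerivedFunctorPlus

lemma commShift_injectiveIso : NatTrans.CommShift (injectiveIso F).hom ℤ :=
  letI : Localization.Lifting (injectiveToDerived A) (MorphismProperty.isomorphisms _)
    ((InjectiveObject.ι A).mapHomotopyCategoryPlus ⋙
        F.mapHomotopyCategoryPlus ⋙ DerivedCategory.Plus.Qh) F.rightDerivedFunctorPlus :=
    ⟨injectiveIso F⟩
  NatTrans.commShift_iso_hom_of_localization (injectiveToDerived A)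
    (MorphismProperty.isomorphisms _) ℤ
    ((InjectiveObject.ι A).mapHomotopyCategoryPlus ⋙
        F.mapHomotopyCategoryPlus ⋙ DerivedCategory.Plus.Qh) F.rightDerivedFunctorPlus

/-- With this commutation with shifts, `RF` is a triangulated functor. -/
instance isTriangulated_rightDerived : F.rightDerivedFunctorPlus.IsTriangulated := by
  have := commShift_injectiveIso F
  exact Functor.isTriangulated_of_precomp_iso (injectiveIso F)

/-- The unit of `RF` is compatible with the shifts. -/
instance commShift_unit : NatTrans.CommShift F.rightDerivedFunctorPlusUnit ℤ where
  shift_comm a := by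
    refine NatTrans.ext (funext fun K ↦ ?_)
    let P := F.mapHomotopyCategoryPlus ⋙ (DerivedCategory.Plus.Qh (C := B))
    let R := DerivedCategory.Plus.Qh (C := A) ⋙ F.rightDerivedFunctorPlus
    let I := (InjectiveObject.ι A).mapHomotopyCategoryPlus
    let η : P ⟶ R := F.rightDerivedFunctorPlusUnit
    change (P.commShiftIso a).hom.app K ≫ (η.app K)⟦a⟧' =
      η.app (K⟦a⟧) ≫ (R.commShiftIso a).hom.app K
    have key (L : HomotopyCategory.Plus (InjectiveObject A)) :
        (P.commShiftIso a).hom.app (I.obj L) ≫ (η.app (I.obj L))⟦a⟧' =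
          η.app ((I.obj L)⟦a⟧) ≫ (R.commShiftIso a).hom.app (I.obj L) := by
      have := commShift_injectiveIso F
      have h : ((I ⋙ P).commShiftIso a).hom.app L ≫ (η.app (I.obj L))⟦a⟧' =
          η.app (I.obj (L⟦a⟧)) ≫ (((I ⋙ DerivedCategory.Plus.Qh) ⋙
            F.rightDerivedFunctorPlus).commShiftIso a).hom.app L :=
        NatTrans.shift_app_comm (injectiveIso F).inv a L
      have h' : (((I ⋙ DerivedCategory.Plus.Qh) ⋙
            F.rightDerivedFunctorPlus).commShiftIso a).hom.app L =
          R.map ((I.commShiftIso a).hom.app L) ≫ (R.commShiftIso a).hom.app (I.obj L) := by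
        simp [Functor.commShiftIso_comp_hom_app, R]
      rw [h', Functor.commShiftIso_comp_hom_app, Category.assoc, ← η.naturality_assoc] at h
      exact (cancel_epi _).1 h
    let r : (HomotopyCategory.Plus.localizerMorphism A).RightResolution K := Classical.arbitrary _
    have hr : IsIso (R.map r.w) := by
      have := Localization.inverts DerivedCategory.Plus.Qh _ _ r.hw
      dsimp [R]
      infer_instance
    rw [← cancel_mono ((R.map r.w)⟦a⟧'), Category.assoc, Category.assoc, ← Functor.map_comp,
      ← η.naturality, Functor.map_comp, ← Functor.commShiftIso_hom_naturality,
      ← Functor.commShiftIso_hom_naturality_assoc, ← η.naturality_assoc]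
    exact congrArg (P.map (r.w⟦a⟧') ≫ ·) (key r.X₁)

/-- For additive functors `F`, `G`, `H` and an isomorphism `e : F ⋙ G ≅ H`, the morphism
`RH ⟶ RF ⋙ RG` induced by `e`: it is given by the universal property of `RH`, i.e. it is the unique
morphism whose composition with the unit `H(K) ⟶ RH(K)` is
`H(K) ≅ G(F(K)) ⟶ RG(F(K)) ⟶ RG(RF(K))`, for all `K` in `K⁺(A)`. -/
noncomputable def rightDerivedComparison [EnoughInjectives B] {F : A ⥤ B} [F.Additive]
    {G : B ⥤ C} [G.Additive] {H : A ⥤ C} [H.Additive] (e : F ⋙ G ≅ H) :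
    H.rightDerivedFunctorPlus ⟶ F.rightDerivedFunctorPlus ⋙ G.rightDerivedFunctorPlus :=
  H.rightDerivedFunctorPlus.rightDerivedDesc H.rightDerivedFunctorPlusUnit
    (HomotopyCategory.Plus.quasiIso A)
    (F.rightDerivedFunctorPlus ⋙ G.rightDerivedFunctorPlus)
    (Functor.whiskerRight (Functor.mapHomotopyCategoryPlusCompIso e).inv DerivedCategory.Plus.Qh ≫
      Functor.whiskerLeft F.mapHomotopyCategoryPlus G.rightDerivedFunctorPlusUnit ≫
      Functor.whiskerRight F.rightDerivedFunctorPlusUnit G.rightDerivedFunctorPlus)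

end DerivedPlus

namespace Sh

variable {X Y Z : TopCat.{u}}

/-- The derived proper direct image `f_! = R f_(!) : D⁺(Y) ⥤ D⁺(X)`. -/
noncomputable abbrev derivedProperDirectImage
    [HasDerivedCategory.{w₁} (Sh Y)] [HasDerivedCategory.{w₂} (Sh X)] (f : Y ⟶ X) :
    DerivedCategory.Plus (Sh Y) ⥤ DerivedCategory.Plus (Sh X) :=
  (properDirectImage f).rightDerivedFunctorPlus

/-- The morphism `(f ∘ g)_! ⟶ f_! ∘ g_!` induced by the identity `f_(!) ∘ g_(!) = (f ∘ g)_(!)`,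
for `f` separated. -/
noncomputable def derivedProperDirectImageComparison
    [HasDerivedCategory.{w₁} (Sh Z)] [HasDerivedCategory.{w₂} (Sh Y)]
    [HasDerivedCategory.{w₃} (Sh X)] (g : Z ⟶ Y) (f : Y ⟶ X) (hf : IsSeparatedMap f) :
    derivedProperDirectImage (g ≫ f) ⟶ derivedProperDirectImage g ⋙ derivedProperDirectImage f :=
  DerivedPlus.rightDerivedComparison (properDirectImageComp g f hf)

end Sh

/-! By the usual argument for composed derived functors, the comparison is invertible as soon as
`g_(!)` sends injective sheaves to sheaves on which `Rf_(!)` is computed by `f_(!)` itself. Every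
object of `D⁺(Z)` is represented by a bounded below complex of injectives `K`. There the units of
`R(f ∘ g)_(!)` and `Rg_(!)` are invertible, and what remains is the unit of `Rf_(!)` at `g_(!) K`.

The class of sheaves that makes this work is `IsRelSoft f`: near a compact subset of a fibre of `f`,
every section agrees with one having proper support over a neighbourhood of the base point. Two
facts carry the proof.

(1) If sections of `F` extend to larger open sets, as for injective `F`, then `g_(!) F` is
relatively soft (`isRelSoft_properDirectImage`). A section is cut off by zero outside a proper
neighbourhood `A` of the compact set, and the gap over the boundary of `A` is filled by extending
sections of `F`.

(2) The class is adapted to `f_(!)` (`isAdapted_isRelSoft`). If the kernel of a short exact sequence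
is relatively soft, a properly supported section of the cokernel lifts near the compact part of its
support in a fibre. Correcting the lift by a section of the kernel makes it vanish near the boundary
of a proper neighbourhood, so it extends by zero (`IsRelSoft.exists_lift_properSections`). Hence
`f_(!)` preserves exactness of the sequence, and quotients of soft sheaves by soft ones are soft.

Compatibility with shifts is formal: on complexes of injectives the comparison is composed of the
inverse of a unit and of transformations already known to commute with shifts. -/

namespace DerivedPlus

open Limits ZeroObject

/-! ### Adapted classes and the unit of the right derived functor -/

section Acyclic

variable {B C : Type*} [Category* B] [Category* C] [Abelian B] [Abelian C]

/-- A class of objects adapted to an additive functor `G`: `G` is exact on short exact sequences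
starting with an object of the class, and the class has the closure properties which are needed
in order to compute the right derived functor of `G` by complexes in the class. -/
structure IsAdapted (P : ObjectProperty B) (G : B ⥤ C) [G.Additive] : Prop where
  injective (I : B) [Injective I] : P I
  biprod (M N : B) : P M → P N → P (M ⊞ N)
  shortExact_map (S : ShortComplex B) : S.ShortExact → P S.X₁ → (S.map G).ShortExact
  quotient (S : ShortComplex B) : S.ShortExact → P S.X₁ → P S.X₂ → P S.X₃

namespace IsAdapted

variable {P : ObjectProperty B} {G : B ⥤ C} [G.Additive] (h : IsAdapted P G)
include h

lemma of_isZero {M : B} (hM : IsZero M) : P M := by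
  have : Injective M := hM.injective
  exact h.injective M

/-- An isomorphism presents its target as the quotient of its source by the zero object, which is
injective; closure under quotients applies. -/
lemma of_iso {M N : B} (e : M ≅ N) (hM : P M) : P N := by
  have hS : (ShortComplex.mk (0 : (0 : B) ⟶ M) e.hom zero_comp).ShortExact :=
    { exact := (ShortComplex.exact_iff_mono _ rfl).2 (by dsimp; infer_instance)
      mono_f := ⟨fun _ _ _ ↦ (isZero_zero B).eq_of_tgt _ _⟩
      epi_g := by dsimp; infer_instance }
  exact h.quotient _ hS (h.of_isZero (isZero_zero B)) hM

/-- An acyclic complex splits into short exact sequences `Zⁱ → Kⁱ → Zⁱ⁺¹`. The cycles vanish far to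
the left, so closure under quotients puts all of them in the class, and `G` keeps every one of these
sequences exact. -/
lemma acyclic_map (K : CochainComplex B ℤ) (n : ℤ) [K.IsStrictlyGE n] (hK : K.Acyclic)
    (hP : ∀ i, P (K.X i)) : ((G.mapHomologicalComplex (.up ℤ)).obj K).Acyclic := by
  let S (i : ℤ) : ShortComplex B := ShortComplex.mk (K.iCycles i) (K.toCycles i (i + 1)) (by
    rw [← cancel_mono (K.iCycles (i + 1)), Category.assoc, K.toCycles_i, K.iCycles_d, zero_comp])
  have hepi (i : ℤ) : Epi (K.toCycles i (i + 1)) :=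
    Preadditive.epi_of_isZero_cokernel' _
      (K.homologyIsCokernel i (i + 1) (by simp)) (hK (i + 1)).isZero_homology
  have hS (i : ℤ) : (S i).ShortExact :=
    { exact := ShortComplex.exact_of_f_is_kernel _ (KernelFork.IsLimit.ofι' _ _ (fun k hk ↦
        ⟨K.liftCycles k (i + 1) (by simp) (by
          rw [← K.toCycles_i, reassoc_of% hk, zero_comp]), by simp [S]⟩))
      mono_f := by dsimp [S]; infer_instance
      epi_g := hepi i }
  have hZ₀ (i : ℤ) (hi : i < n) : P (K.cycles i) :=
    h.of_isZero (IsZero.of_mono (K.iCycles i) (K.isZero_of_isStrictlyGE n i hi))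
  have hZ₁ (k : ℕ) : P (K.cycles (n - 1 + k)) := by
    induction k with
    | zero => exact hZ₀ _ (by lia)
    | succ k ih =>
      have := h.quotient _ (hS (n - 1 + k)) ih (hP _)
      rwa [Nat.cast_add, Nat.cast_one, ← add_assoc]
  have hZ (i : ℤ) : P (K.cycles i) := by
    by_cases hi : n - 1 ≤ i
    · obtain ⟨k, rfl⟩ := Int.le.dest hi
      exact hZ₁ k
    · exact hZ₀ _ (by lia)
  have hGS (i : ℤ) : ((S i).map G).ShortExact := h.shortExact_map _ (hS i) (hZ i)
  intro j
  obtain ⟨i, rfl⟩ : ∃ i, j = i + 1 := ⟨j - 1, by lia⟩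
  rw [HomologicalComplex.exactAt_iff' _ i (i + 1) (i + 1 + 1) (by simp) (by simp)]
  -- `T` is `G(Kⁱ) → G(Kⁱ⁺¹) → G(Zⁱ⁺²)`. It differs from `G(Zⁱ⁺¹) → G(Kⁱ⁺¹) → G(Zⁱ⁺²)` by an
  -- epimorphism on the left, and from the image of `K` by a monomorphism on the right, so the three
  -- are exact together.
  let T : ShortComplex C := ShortComplex.mk (G.map (K.d i (i + 1)))
    (G.map (K.toCycles (i + 1) (i + 1 + 1))) (by
      rw [← G.map_comp, ← K.toCycles_i i (i + 1), Category.assoc, (S (i + 1)).zero, comp_zero,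
        G.map_zero])
  let α : T ⟶ (S (i + 1)).map G :=
    { τ₁ := G.map (K.toCycles i (i + 1))
      τ₂ := 𝟙 _
      τ₃ := 𝟙 _
      comm₁₂ := by
        refine (G.map_comp _ _).symm.trans ((congrArg G.map ?_).trans (Category.comp_id _).symm)
        exact K.toCycles_i i (i + 1)
      comm₂₃ := (Category.id_comp _).trans (Category.comp_id _).symm }
  let β : T ⟶ ((G.mapHomologicalComplex (.up ℤ)).obj K).sc' i (i + 1) (i + 1 + 1) :=
    { τ₁ := 𝟙 _
      τ₂ := 𝟙 _
      τ₃ := G.map (K.iCycles (i + 1 + 1))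
      comm₁₂ := (Category.id_comp _).trans (Category.comp_id _).symm
      comm₂₃ := by
        refine (Category.id_comp _).trans (Eq.trans (congrArg G.map ?_) (G.map_comp _ _))
        exact (K.toCycles_i (i + 1) (i + 1 + 1)).symm }
  have : Epi α.τ₁ := (hGS i).epi_g
  have : IsIso α.τ₂ := inferInstanceAs (IsIso (𝟙 (G.obj (K.X (i + 1)))))
  have : Mono α.τ₃ := inferInstanceAs (Mono (𝟙 (G.obj (K.cycles (i + 1 + 1)))))
  have : Epi β.τ₁ := inferInstanceAs (Epi (𝟙 (G.obj (K.X i))))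
  have : IsIso β.τ₂ := inferInstanceAs (IsIso (𝟙 (G.obj (K.X (i + 1)))))
  have : Mono β.τ₃ := (hGS (i + 1 + 1)).mono_f
  rw [← ShortComplex.exact_iff_of_epi_of_isIso_of_mono β,
    ShortComplex.exact_iff_of_epi_of_isIso_of_mono α]
  exact (hGS (i + 1)).exact

/-- The mapping cone of `φ` is acyclic with terms `Kⁱ⁺¹ ⊞ Lⁱ` in the class, so its image, the cone
of the image of `φ`, is acyclic. -/
lemma quasiIso_map {K L : HomotopyCategory.Plus B} (φ : K ⟶ L)
    (hφ : HomotopyCategory.Plus.quasiIso B φ) (hK : ∀ i, P (K.obj.as.X i))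
    (hL : ∀ i, P (L.obj.as.X i)) :
    HomotopyCategory.Plus.quasiIso C (G.mapHomotopyCategoryPlus.map φ) := by
  obtain ⟨K, rfl⟩ := HomotopyCategory.Plus.quotient_obj_surjective K
  obtain ⟨L, rfl⟩ := HomotopyCategory.Plus.quotient_obj_surjective L
  obtain ⟨φ, rfl⟩ := (HomotopyCategory.Plus.quotient B).map_surjective φ
  obtain ⟨K, n₁, _⟩ := K
  obtain ⟨L, n₂, _⟩ := L
  obtain ⟨φ : K ⟶ L⟩ := φ
  change HomotopyCategory.quasiIso C _ ((G.mapHomotopyCategory _).map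
    ((HomotopyCategory.quotient _ _).map φ))
  change HomotopyCategory.quasiIso B _ ((HomotopyCategory.quotient _ _).map φ) at hφ
  have hT := HomotopyCategory.mappingCone_triangleh_distinguished φ
  have hGT := (G.mapHomotopyCategory (.up ℤ)).map_distinguished _ hT
  rw [HomotopyCategory.quasiIso_eq_trW_subcategoryAcyclic] at hφ ⊢
  refine ((HomotopyCategory.subcategoryAcyclic C).trW_iff_of_distinguished _ hGT).2 ?_
  replace hφ := ((HomotopyCategory.subcategoryAcyclic B).trW_iff_of_distinguished _ hT).1 hφ
  replace hφ := (HomotopyCategory.quotient_obj_mem_subcategoryAcyclic_iff_acyclic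
    (CochainComplex.mappingCone φ)).1 hφ
  refine (HomotopyCategory.quotient_obj_mem_subcategoryAcyclic_iff_acyclic
    ((G.mapHomologicalComplex _).obj (CochainComplex.mappingCone φ))).2 ?_
  -- The bound is `n₁ - 1` on the side of `K` because `K` enters the cone shifted by one.
  have := CochainComplex.isStrictlyGE_mappingCone φ n₁ n₂ (min (n₁ - 1) n₂)
  refine h.acyclic_map _ (min (n₁ - 1) n₂) hφ fun i ↦ ?_
  have := HomologicalComplex.HasHomotopyCofiber.hasBinaryBiproduct φ i (i + 1) rfl
  exact h.of_iso (HomologicalComplex.homotopyCofiber.XIsoBiprod φ i (i + 1) rfl).symm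
    (h.biprod _ _ (hK _) (hL _))

variable [HasDerivedCategory B] [HasDerivedCategory C] [EnoughInjectives B]

/-- Compare `K` with an injective resolution `r.w`: `G` maps it to a quasi-isomorphism by
`quasiIso_map`, and the unit is invertible on injectives. Naturality of the unit gives the claim for
`K`. -/
lemma isIso_unit_app (K : HomotopyCategory.Plus B) (hK : ∀ i, P (K.obj.as.X i)) :
    IsIso (G.rightDerivedFunctorPlusUnit.app K) := by
  let r : (HomotopyCategory.Plus.localizerMorphism B).RightResolution K := Classical.arbitrary _
  have h₁ : IsIso (DerivedCategory.Plus.Qh.map r.w) :=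
    Localization.inverts DerivedCategory.Plus.Qh _ _ r.hw
  have h₂ : IsIso (DerivedCategory.Plus.Qh.map (G.mapHomotopyCategoryPlus.map r.w)) :=
    Localization.inverts DerivedCategory.Plus.Qh _ _ (h.quasiIso_map r.w r.hw hK
      (fun i ↦ by
        have : Injective ((((InjectiveObject.ι B).mapHomotopyCategoryPlus.obj r.X₁).obj.as.X i)) :=
          inferInstance
        exact h.injective _))
  have h₃ : IsIso (G.rightDerivedFunctorPlusUnit.app
    ((InjectiveObject.ι B).mapHomotopyCategoryPlus.obj r.X₁)) := inferInstance
  have nat := G.rightDerivedFunctorPlusUnit.naturality r.w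
  have : IsIso ((DerivedCategory.Plus.Qh ⋙ G.rightDerivedFunctorPlus).map r.w) := by
    dsimp; infer_instance
  have : IsIso (G.rightDerivedFunctorPlusUnit.app K ≫
    (DerivedCategory.Plus.Qh ⋙ G.rightDerivedFunctorPlus).map r.w) := by
    rw [← nat]
    exact @IsIso.comp_isIso _ _ _ _ _ _ _ h₂ h₃
  exact IsIso.of_isIso_comp_right _
    ((DerivedCategory.Plus.Qh ⋙ G.rightDerivedFunctorPlus).map r.w)

end IsAdapted

end Acyclic

/-! ### Transporting compatibility with shifts along functors -/

section CommShift

variable {C₁ C₂ C₃ D₁ D₂ D₃ : Type*} [Category* C₁] [Category* C₂] [Category* C₃] [Category* D₁]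
  [Category* D₂] [Category* D₃] {M : Type*} [AddMonoid M] [HasShift C₁ M] [HasShift C₂ M]
  [HasShift C₃ M] [HasShift D₁ M] [HasShift D₂ M] [HasShift D₃ M]

/-- The identity to be checked is natural in the object, so it carries over along an isomorphism
from an object in the image of `L`. -/
lemma commShift_of_whiskerLeft (L : C₁ ⥤ D₁) [L.EssSurj] [L.CommShift M] {F G : D₁ ⥤ D₂}
    [F.CommShift M] [G.CommShift M] (τ : F ⟶ G)
    [h : NatTrans.CommShift (Functor.whiskerLeft L τ) M] : NatTrans.CommShift τ M where
  shift_comm a := by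
    ext X
    let i := L.objObjPreimageIso X
    let K := L.objPreimage X
    have hK : (F.commShiftIso a).hom.app (L.obj K) ≫ (τ.app (L.obj K))⟦a⟧' =
        τ.app ((L.obj K)⟦a⟧) ≫ (G.commShiftIso a).hom.app (L.obj K) := by
      have := NatTrans.shift_app_comm (Functor.whiskerLeft L τ) a K
      rw [Functor.commShiftIso_comp_hom_app, Functor.commShiftIso_comp_hom_app,
        Functor.whiskerLeft_app, Functor.whiskerLeft_app, Category.assoc,
        ← τ.naturality_assoc] at this
      exact (cancel_epi _).1 this
    rw [← cancel_epi (F.map (i.hom⟦a⟧'))]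
    have h₁ := (F.commShiftIso a).hom.naturality i.hom
    have h₂ := (G.commShiftIso a).hom.naturality i.hom
    dsimp at h₁ h₂ ⊢
    rw [reassoc_of% h₁, ← Functor.map_comp, τ.naturality, τ.naturality_assoc, h₂,
      Functor.map_comp, reassoc_of% hK]

lemma commShift_of_whiskerRight (L : D₂ ⥤ C₂) [L.Faithful] [L.CommShift M] {F G : D₁ ⥤ D₂}
    [F.CommShift M] [G.CommShift M] (τ : F ⟶ G)
    [h : NatTrans.CommShift (Functor.whiskerRight τ L) M] : NatTrans.CommShift τ M where
  shift_comm a := by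
    ext X
    apply L.map_injective
    rw [← cancel_mono ((L.commShiftIso a).hom.app _)]
    have := NatTrans.shift_app_comm (Functor.whiskerRight τ L) a X
    rw [Functor.commShiftIso_comp_hom_app, Functor.commShiftIso_comp_hom_app] at this
    have h₁ := (L.commShiftIso a).hom.naturality (τ.app X)
    dsimp at this h₁ ⊢
    rw [Functor.map_comp, Functor.map_comp, Category.assoc, Category.assoc, h₁, ← this,
      Category.assoc]

variable {L₁ : C₁ ⥤ D₁} {L₂ : C₂ ⥤ D₂} {L₃ : C₃ ⥤ D₃} {F : C₁ ⥤ C₂} {G : C₂ ⥤ C₃} {H : C₁ ⥤ C₃}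
  {F' : D₁ ⥤ D₂} {G' : D₂ ⥤ D₃} {H' : D₁ ⥤ D₃}
  [L₁.CommShift M] [L₂.CommShift M] [L₃.CommShift M]
  [F.CommShift M] [G.CommShift M] [H.CommShift M]
  [F'.CommShift M] [G'.CommShift M] [H'.CommShift M]
  (φ : F ⋙ L₂ ≅ L₁ ⋙ F') (γ : G ⋙ L₃ ≅ L₂ ⋙ G') (η : H ⋙ L₃ ≅ L₁ ⋙ H')
  [NatTrans.CommShift φ.hom M] [NatTrans.CommShift γ.hom M] [NatTrans.CommShift η.hom M]
  (τ : F ⋙ G ⟶ H) (τ' : F' ⋙ G' ⟶ H')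
  (fac : ∀ X, γ.hom.app (F.obj X) ≫ G'.map (φ.hom.app X) ≫ τ'.app (L₁.obj X) =
    L₃.map (τ.app X) ≫ η.hom.app X)
include φ γ η fac

/-- By `fac`, the restriction of `τ'` along `L₁` is `τ` conjugated by the isomorphisms of the
squares. This descends compatibility from complexes to the homotopy category. -/
lemma commShift_of_square_of_essSurj [L₁.EssSurj] [NatTrans.CommShift τ M] :
    NatTrans.CommShift τ' M := by
  have : Functor.whiskerLeft L₁ τ' =
      (Functor.associator _ _ _).inv ≫ Functor.whiskerRight φ.inv G' ≫
      (Functor.associator _ _ _).hom ≫ Functor.whiskerLeft F γ.inv ≫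
      (Functor.associator _ _ _).inv ≫ Functor.whiskerRight τ L₃ ≫ η.hom := by
    ext X
    have h := fac X
    dsimp
    simp only [Category.id_comp]
    rw [← h, Iso.inv_hom_id_app_assoc, ← Functor.map_comp_assoc, Iso.inv_hom_id_app]
    simp
  have : NatTrans.CommShift (Functor.whiskerLeft L₁ τ') M := by
    rw [this]
    infer_instance
  exact commShift_of_whiskerLeft L₁ τ'

/-- The converse passage: `τ` followed by `L₃` is recovered from `τ'`. It serves to restrict from
the homotopy category to its bounded below part. -/
lemma commShift_of_square_of_faithful [L₃.Faithful] [NatTrans.CommShift τ' M] :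
    NatTrans.CommShift τ M := by
  have : Functor.whiskerRight τ L₃ =
      (Functor.associator _ _ _).hom ≫ Functor.whiskerLeft F γ.hom ≫
      (Functor.associator _ _ _).inv ≫ Functor.whiskerRight φ.hom G' ≫
      (Functor.associator _ _ _).hom ≫ Functor.whiskerLeft L₁ τ' ≫ η.inv := by
    ext X
    have h := fac X
    dsimp
    simp only [Category.id_comp]
    rw [reassoc_of% h, Iso.hom_inv_id_app]
    simp
  have : NatTrans.CommShift (Functor.whiskerRight τ L₃) M := by
    rw [this]
    infer_instance
  exact commShift_of_whiskerRight L₃ τ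

end CommShift

/-! ### The comparison morphism: invertibility and compatibility with shifts -/

variable {A B C : Type*} [Category* A] [Category* B] [Category* C] [Abelian A] [Abelian B]
  [Abelian C]

section

variable {F : A ⥤ B} [F.Additive] {G : B ⥤ C} [G.Additive] {H : A ⥤ C} [H.Additive]
  (e : F ⋙ G ≅ H)

instance commShift_mapHomologicalComplexCompIso :
    NatTrans.CommShift (Functor.mapHomologicalComplexCompIso e (.up ℤ)).hom ℤ where
  shift_comm a := by
    ext K i
    rw [NatTrans.comp_app, NatTrans.comp_app, Functor.commShiftIso_comp_hom_app]
    -- In each degree the shift isomorphisms are identities, so both sides reduce to a component of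
    -- `e`.
    exact ((congrArg (· ≫ _) ((congrArg (· ≫ _) (G.map_id _)).trans (Category.id_comp _))).trans
        (Category.id_comp _)).trans (Category.comp_id _).symm

instance commShift_mapHomotopyCategoryCompIso :
    NatTrans.CommShift (Functor.mapHomotopyCategoryCompIso e (.up ℤ)).hom ℤ :=
  commShift_of_square_of_essSurj (F.mapHomotopyCategoryFactors (.up ℤ)).symm
    (G.mapHomotopyCategoryFactors (.up ℤ)).symm (H.mapHomotopyCategoryFactors (.up ℤ)).symm
    (Functor.mapHomologicalComplexCompIso e (.up ℤ)).hom _ (fun K ↦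
      (Category.id_comp _).trans
        (((congrArg (· ≫ _) (CategoryTheory.Functor.map_id _ _)).trans
          (Category.id_comp _)).trans (Category.comp_id _).symm))

variable (F) in
/-- The functor induced by `F` between the bounded below homotopy categories is induced by the
functor between the homotopy categories. -/
def mapHomotopyCategoryPlusCompι : F.mapHomotopyCategoryPlus ⋙ HomotopyCategory.Plus.ι B ≅
    HomotopyCategory.Plus.ι A ⋙ F.mapHomotopyCategory (.up ℤ) :=
  (HomotopyCategory.plus B).liftCompιIso _ _

instance : NatTrans.CommShift (mapHomotopyCategoryPlusCompι F).hom ℤ :=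
  Functor.CommShift.ofComp_compatibility (F := F.mapHomotopyCategoryPlus)
    (mapHomotopyCategoryPlusCompι F) ℤ

instance commShift_mapHomotopyCategoryPlusCompIso :
    NatTrans.CommShift (Functor.mapHomotopyCategoryPlusCompIso e).hom ℤ :=
  commShift_of_square_of_faithful (mapHomotopyCategoryPlusCompι F)
    (mapHomotopyCategoryPlusCompι G) (mapHomotopyCategoryPlusCompι H) _
    (Functor.mapHomotopyCategoryCompIso e (.up ℤ)).hom (fun K ↦
      (Category.id_comp _).trans
        (((congrArg (· ≫ _) (CategoryTheory.Functor.map_id _ _)).trans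
          (Category.id_comp _)).trans (Category.comp_id _).symm))

end

variable [HasDerivedCategory A] [HasDerivedCategory B] [HasDerivedCategory C]
  [EnoughInjectives A] [EnoughInjectives B]
  {F : A ⥤ B} [F.Additive] {G : B ⥤ C} [G.Additive] {H : A ⥤ C} [H.Additive]
  (e : F ⋙ G ≅ H)

/-- The comparison morphism `RH ⟶ RF ⋙ RG` is an isomorphism if `F` sends injective objects to
objects in a class which is adapted to `G`. -/
theorem isIso_rightDerivedComparison (P : ObjectProperty B) (hP : IsAdapted P G)
    (hF : ∀ (I : A) [Injective I], P (F.obj I)) : IsIso (rightDerivedComparison e) := by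
  rw [NatTrans.isIso_iff_isIso_app]
  intro X
  let K := (InjectiveObject.ι A).mapHomotopyCategoryPlus.obj
    ((injectiveToDerived A).objPreimage X)
  let i : DerivedCategory.Plus.Qh.obj K ≅ X := (injectiveToDerived A).objObjPreimageIso X
  rw [← NatTrans.isIso_app_iff_of_iso _ i]
  have hK (n : ℤ) : Injective (K.obj.as.X n) :=
    (((injectiveToDerived A).objPreimage X).obj.as.X n).property
  have h₁ : IsIso (G.rightDerivedFunctorPlusUnit.app (F.mapHomotopyCategoryPlus.obj K)) :=
    hP.isIso_unit_app _ fun n ↦ @hF _ (hK n)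
  have h₂ : IsIso (F.rightDerivedFunctorPlusUnit.app K) := inferInstance
  have h₃ : IsIso (H.rightDerivedFunctorPlusUnit.app K) := inferInstance
  have fac := H.rightDerivedFunctorPlus.rightDerived_fac_app H.rightDerivedFunctorPlusUnit
    (HomotopyCategory.Plus.quasiIso A) (F.rightDerivedFunctorPlus ⋙ G.rightDerivedFunctorPlus)
    (Functor.whiskerRight (Functor.mapHomotopyCategoryPlusCompIso e).inv DerivedCategory.Plus.Qh ≫
      Functor.whiskerLeft F.mapHomotopyCategoryPlus G.rightDerivedFunctorPlusUnit ≫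
      Functor.whiskerRight F.rightDerivedFunctorPlusUnit G.rightDerivedFunctorPlus) K
  -- In `fac` the unit of `RH` followed by the comparison is a composite of the isomorphism from `e`
  -- and the units of `RG` and `RF`, all invertible at `K`.
  refine @IsIso.of_isIso_fac_left _ _ _ _ _ _ _ _ h₃ ?_ fac
  dsimp
  infer_instance

instance commShift_rightDerivedComparison :
    NatTrans.CommShift (rightDerivedComparison e) ℤ := by
  let I := (InjectiveObject.ι A).mapHomotopyCategoryPlus
  let Q := DerivedCategory.Plus.Qh (C := A)
  let η := Functor.whiskerLeft I H.rightDerivedFunctorPlusUnit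
  have hη (K) : IsIso (η.app K) :=
    inferInstanceAs (IsIso (H.rightDerivedFunctorPlusUnit.app (I.obj K)))
  have : IsIso η := NatIso.isIso_of_isIso_app _
  have : NatTrans.CommShift (inv η) ℤ := by
    have : NatTrans.CommShift (asIso η).hom ℤ := inferInstanceAs (NatTrans.CommShift
      (Functor.whiskerLeft I H.rightDerivedFunctorPlusUnit) ℤ)
    exact NatTrans.CommShift.of_iso_inv (asIso η) ℤ
  have fac : Functor.whiskerLeft (I ⋙ Q) (rightDerivedComparison e) =
      (Functor.associator _ _ _).hom ≫ inv η ≫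
      Functor.whiskerLeft I (Functor.whiskerRight
        (Functor.mapHomotopyCategoryPlusCompIso e).inv DerivedCategory.Plus.Qh ≫
        (Functor.associator _ _ _).hom ≫
        Functor.whiskerLeft F.mapHomotopyCategoryPlus G.rightDerivedFunctorPlusUnit ≫
        (Functor.associator _ _ _).inv ≫
        Functor.whiskerRight F.rightDerivedFunctorPlusUnit G.rightDerivedFunctorPlus ≫
        (Functor.associator _ _ _).hom) ≫
      (Functor.associator _ _ _).inv := by
    refine NatTrans.ext (funext fun K ↦ ?_)
    have h := H.rightDerivedFunctorPlus.rightDerived_fac_app H.rightDerivedFunctorPlusUnit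
      (HomotopyCategory.Plus.quasiIso A) (F.rightDerivedFunctorPlus ⋙ G.rightDerivedFunctorPlus)
      (Functor.whiskerRight (Functor.mapHomotopyCategoryPlusCompIso e).inv
          DerivedCategory.Plus.Qh ≫
        Functor.whiskerLeft F.mapHomotopyCategoryPlus G.rightDerivedFunctorPlusUnit ≫
        Functor.whiskerRight F.rightDerivedFunctorPlusUnit G.rightDerivedFunctorPlus) (I.obj K)
    change (rightDerivedComparison e).app (Q.obj (I.obj K)) = _
    rw [← cancel_epi (η.app K)]
    refine Eq.trans h ?_
    simp [I, Q]
  have : NatTrans.CommShift (Functor.whiskerLeft (I ⋙ Q) (rightDerivedComparison e)) ℤ := by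
    rw [fac]
    infer_instance
  have : (I ⋙ Q).EssSurj := inferInstanceAs (injectiveToDerived A).EssSurj
  exact commShift_of_whiskerLeft (I ⋙ Q) _

end DerivedPlus

/-! ### Sections of sheaves: gluing, exactness and extension from open subsets -/

namespace Sh

open Limits

variable {X Y Z : TopCat.{u}}

/-- The restriction of sections of a sheaf to a smaller open subset. -/
def res (F : Sh Y) {V W : Opens Y} (h : W ≤ V) :
    F.presheaf.obj (op V) →+ F.presheaf.obj (op W) :=
  (F.presheaf.map (homOfLE h).op).hom

/-- The homomorphism on sections over `V` given by a morphism of sheaves. -/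
def onSections {F G : Sh Y} (φ : F ⟶ G) (V : Opens Y) :
    F.presheaf.obj (op V) →+ G.presheaf.obj (op V) :=
  (φ.1.app (op V)).hom

@[simp]
lemma res_res (F : Sh Y) {V W T : Opens Y} (h : W ≤ V) (h' : T ≤ W) (s : F.presheaf.obj (op V)) :
    res F h' (res F h s) = res F (h'.trans h) s :=
  (ConcreteCategory.congr_hom (F.presheaf.map_comp (homOfLE h).op (homOfLE h').op) s).symm

@[simp]
lemma res_self (F : Sh Y) {V : Opens Y} (s : F.presheaf.obj (op V)) :
    res F le_rfl s = s :=
  ConcreteCategory.congr_hom (F.presheaf.map_id (op V)) s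

lemma onSections_res {F G : Sh Y} (φ : F ⟶ G) {V W : Opens Y} (h : W ≤ V)
    (s : F.presheaf.obj (op V)) : onSections φ W (res F h s) = res G h (onSections φ V s) :=
  ConcreteCategory.congr_hom (φ.1.naturality (homOfLE h).op) s

lemma supp_onSections {F G : Sh Y} (φ : F ⟶ G) {V : Opens Y} (s : F.presheaf.obj (op V)) :
    supp G (onSections φ V s) ⊆ supp F s :=
  supp_app φ s

lemma notMem_supp_iff_res (F : Sh Y) {V : Opens Y} (s : F.presheaf.obj (op V)) {y : Y}
    (hy : y ∈ V) : y ∉ supp F s ↔ ∃ W : Opens Y, y ∈ W ∧ ∃ h : W ≤ V, res F h s = 0 :=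
  (notMem_supp_iff F s y hy).trans
    ⟨fun ⟨W, hW, i, e⟩ ↦ ⟨W, hW, i.le, e⟩, fun ⟨W, hW, h, e⟩ ↦ ⟨W, hW, homOfLE h, e⟩⟩

lemma res_eq_zero_iff (F : Sh Y) {V W : Opens Y} (h : W ≤ V) (s : F.presheaf.obj (op V)) :
    res F h s = 0 ↔ Disjoint (supp F s) W := by
  constructor
  · intro h0
    rw [Set.disjoint_left]
    intro y hy hyW
    exact (notMem_supp_iff_res F s (h hyW)).2 ⟨W, hyW, h, h0⟩ hy
  · intro hd
    by_contra hne
    obtain ⟨y, hyW, hy⟩ := exists_of_mem_nhds F (homOfLE h) s hne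
    exact Set.disjoint_left.1 hd hy hyW

lemma isClosed_supp_union_compl (F : Sh Y) {V : Opens Y} (s : F.presheaf.obj (op V)) :
    IsClosed (supp F s ∪ (V : Set Y)ᶜ) := by
  rw [← isOpen_compl_iff, isOpen_iff_mem_nhds]
  intro y hy
  simp only [Set.compl_union, compl_compl, Set.mem_inter_iff, Set.mem_compl_iff] at hy
  obtain ⟨W, hyW, h, h0⟩ := (notMem_supp_iff_res F s hy.2).1 hy.1
  refine Filter.mem_of_superset (W.isOpen.mem_nhds hyW) fun z hz ↦ ?_
  simp only [Set.compl_union, compl_compl, Set.mem_inter_iff, Set.mem_compl_iff]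
  exact ⟨(notMem_supp_iff_res F s (h hz)).2 ⟨W, hz, h, h0⟩, h hz⟩

lemma section_ext₂ (F : Sh Y) {V V₁ V₂ : Opens Y} (h₁ : V₁ ≤ V) (h₂ : V₂ ≤ V) (hV : V ≤ V₁ ⊔ V₂)
    {s t : F.presheaf.obj (op V)} (e₁ : res F h₁ s = res F h₁ t) (e₂ : res F h₂ s = res F h₂ t) :
    s = t :=
  F.eq_of_locally_eq₂ (homOfLE h₁) (homOfLE h₂) hV s t e₁ e₂

lemma exists_glue₂ (F : Sh Y) {V V₁ V₂ : Opens Y} (h₁ : V₁ ≤ V) (h₂ : V₂ ≤ V) (hV : V ≤ V₁ ⊔ V₂)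
    (s₁ : F.presheaf.obj (op V₁)) (s₂ : F.presheaf.obj (op V₂))
    (e : res F (inf_le_left : V₁ ⊓ V₂ ≤ V₁) s₁ = res F (inf_le_right : V₁ ⊓ V₂ ≤ V₂) s₂) :
    ∃ s : F.presheaf.obj (op V), res F h₁ s = s₁ ∧ res F h₂ s = s₂ := by
  let U : Bool → Opens Y := fun b ↦ bif b then V₁ else V₂
  let sf : ∀ b, F.presheaf.obj (op (U b)) := fun b ↦ match b with
    | true => s₁
    | false => s₂
  obtain ⟨s, hs, -⟩ := F.existsUnique_gluing' U V
    (fun b ↦ homOfLE (match b with | true => h₁ | false => h₂))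
    (hV.trans (sup_le (le_iSup U true) (le_iSup U false))) sf (by
      rintro (_ | _) (_ | _)
      · rfl
      · have := congrArg (res F (inf_comm V₁ V₂).ge) e
        rw [res_res, res_res] at this
        exact this.symm
      · exact e
      · rfl)
  exact ⟨s, hs true, hs false⟩

lemma onSections_injective {F G : Sh Y} (φ : F ⟶ G) [Mono φ] (V : Opens Y) :
    Function.Injective (onSections φ V) := by
  have h : Mono ((TopCat.Sheaf.forget _ _).map φ) := inferInstance
  have h' : Mono (((TopCat.Sheaf.forget _ _).map φ).app (op V)) := inferInstance
  exact (AddCommGrpCat.mono_iff_injective _).1 h'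

lemma mono_of_onSections_injective {F G : Sh Y} (φ : F ⟶ G)
    (h : ∀ V, Function.Injective (onSections φ V)) : Mono φ := by
  have : Mono ((TopCat.Sheaf.forget _ _).map φ) := by
    have (V : (Opens Y)ᵒᵖ) : Mono (((TopCat.Sheaf.forget _ _).map φ).app V) :=
      (AddCommGrpCat.mono_iff_injective _).2 (h V.unop)
    exact NatTrans.mono_of_mono_app _
  exact (TopCat.Sheaf.forget _ _).mono_of_mono_map this

lemma epi_iff_locally_surjective {F G : Sh Y} (φ : F ⟶ G) :
    Epi φ ↔ ∀ (V : Opens Y) (t : G.presheaf.obj (op V)), ∀ y ∈ V, ∃ (W : Opens Y) (h : W ≤ V),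
      y ∈ W ∧ ∃ s : F.presheaf.obj (op W), onSections φ W s = res G h t := by
  rw [← TopCat.Sheaf.isLocallySurjective_iff_epi, TopCat.Presheaf.isLocallySurjective_iff]
  exact forall_congr' fun V ↦ forall_congr' fun t ↦ forall_congr' fun y ↦ forall_congr' fun hy ↦
    exists_congr fun W ↦ exists_congr fun h ↦ and_comm

/-- Exactness on sections over every open set makes the map onto the kernel sheaf surjective on
sections, hence an epimorphism. -/
lemma exact_of_onSections (S : ShortComplex (Sh Y))
    (h : ∀ (V : Opens Y) (s : S.X₂.presheaf.obj (op V)), onSections S.g V s = 0 →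
      ∃ t, onSections S.f V t = s) : S.Exact := by
  rw [S.exact_iff_epi_kernel_lift, epi_iff_locally_surjective]
  intro V k y hy
  have comp {F G H : Sh Y} (φ : F ⟶ G) (ψ : G ⟶ H) (s : F.presheaf.obj (op V)) :
    onSections ψ V (onSections φ V s) = onSections (φ ≫ ψ) V s := rfl
  obtain ⟨t, ht⟩ := h V (onSections (kernel.ι S.g) V k) (by
    rw [comp, kernel.condition]; rfl)
  refine ⟨V, le_rfl, hy, t, onSections_injective (kernel.ι S.g) V ?_⟩
  rw [comp, kernel.lift_ι, ht, res_self]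

lemma exists_of_onSections_eq_zero {S : ShortComplex (Sh Y)} (hS : S.ShortExact) {V : Opens Y}
    (s : S.X₂.presheaf.obj (op V)) (h : onSections S.g V s = 0) : ∃ t, onSections S.f V t = s :=
  TopCat.Sheaf.sections_exact_of_left_exact hS.exact hS.mono_f s h

/-- If `F` is an injective sheaf of abelian groups, the restriction maps of `F` along
monomorphisms are surjective. -/
lemma map_surjective_of_injective {C : Type u} [SmallCategory C] {J : GrothendieckTopology C}
    (F : Sheaf J AddCommGrpCat.{u}) (hF : Injective F) {V W : C} (i : W ⟶ V) [Mono i] :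
    Function.Surjective (F.obj.map i.op) := by
  let free : (Cᵒᵖ ⥤ Type u) ⥤ (Cᵒᵖ ⥤ AddCommGrpCat.{u}) :=
    (Functor.whiskeringRight _ _ _).obj AddCommGrpCat.free
  let ι : yoneda.obj W ⟶ yoneda.obj V := yoneda.map i
  have : Mono ι := inferInstance
  have : Mono (free.map ι) := by
    have (U : Cᵒᵖ) : Mono ((free.map ι).app U) := by
      dsimp [free]; infer_instance
    exact NatTrans.mono_of_mono_app _
  have : Mono ((presheafToSheaf J AddCommGrpCat.{u}).map (free.map ι)) := inferInstance
  -- Sections over `U` are morphisms from the sheafified free abelian presheaf on `U`. Under `e`,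
  -- restriction along `i` is precomposition with a monomorphism, so injectivity of `F` provides the
  -- extension.
  let e (U : C) : ((presheafToSheaf J _).obj (free.obj (yoneda.obj U)) ⟶ F) ≃
      F.obj.obj (op U) :=
    ((sheafificationAdjunction J AddCommGrpCat.{u}).homEquiv _ F).trans
      (((AddCommGrpCat.adj.whiskerRight Cᵒᵖ).homEquiv _ _).trans yonedaEquiv)
  have he (α : (presheafToSheaf J _).obj (free.obj (yoneda.obj V)) ⟶ F) :
      e W ((presheafToSheaf J AddCommGrpCat.{u}).map (free.map ι) ≫ α) =
        F.obj.map i.op (e V α) := by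
    dsimp only [e, Equiv.trans_apply]
    rw [Adjunction.homEquiv_naturality_left]
    refine (congrArg yonedaEquiv (Adjunction.homEquiv_naturality_left _ ι _)).trans ?_
    exact (yonedaEquiv_naturality _ i).symm
  intro s
  refine ⟨e V (Injective.factorThru ((e W).symm s)
    ((presheafToSheaf J AddCommGrpCat.{u}).map (free.map ι))), ?_⟩
  rw [← he, Injective.comp_factorThru, Equiv.apply_symm_apply]

/-- Sections of an injective sheaf extend to larger open subsets. -/
lemma res_surjective_of_injective (F : Sh Y) (hF : Injective F) {V W : Opens Y} (h : W ≤ V) :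
    Function.Surjective (res F h) :=
  map_surjective_of_injective (J := Opens.grothendieckTopology Y) F hF (homOfLE h)

end Sh

/-! ### Point-set topology of separated and locally proper maps -/

/-- Outside `W` the two sets are disjoint compact subsets of one fibre, so separatedness of `f`
gives them disjoint open neighbourhoods; `W` is then added back to both. This confines the overlap
in a gluing to the region where the sections agree. -/
lemma IsSeparatedMap.exists_open_inter_subset {Y X : Type*} [TopologicalSpace Y] {f : Y → X}
    (hf : IsSeparatedMap f) {x : X} {K L : Set Y}
    (hK : IsCompact K) (hL : IsCompact L) (hKx : K ⊆ f ⁻¹' {x}) (hLx : L ⊆ f ⁻¹' {x}) {W : Set Y}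
    (hW : IsOpen W) (h : K ∩ L ⊆ W) :
    ∃ N M : Set Y, IsOpen N ∧ IsOpen M ∧ K ⊆ N ∧ L ⊆ M ∧ N ∩ M ⊆ W := by
  have hd : Disjoint (𝓝ˢ (K \ W)) (𝓝ˢ (L \ W)) := by
    rw [(hK.diff hW).disjoint_nhdsSet_left]
    intro a ha
    rw [(hL.diff hW).disjoint_nhdsSet_right]
    intro b hb
    refine isSeparatedMap_iff_disjoint_nhds.1 hf a b ((hKx ha.1).trans (hLx hb.1).symm) ?_
    rintro rfl
    exact ha.2 (h ⟨ha.1, hb.1⟩)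
  obtain ⟨N, M, hN, hM, hKN, hLM, hNM⟩ := separatedNhds_iff_disjoint.2 hd
  refine ⟨W ∪ N, W ∪ M, hW.union hN, hW.union hM, Set.sdiff_subset_iff.1 hKN,
    Set.sdiff_subset_iff.1 hLM, ?_⟩
  rintro y ⟨hy | hy, hy' | hy'⟩
  · exact hy
  · exact hy
  · exact hy'
  · exact (Set.disjoint_left.1 hNM hy hy').elim

section ProperOver

variable {Y X : Type*} [TopologicalSpace Y] [TopologicalSpace X] {f : Y → X}

/-- A subset `A` of `Y` is proper over a subset `U` of `X`: if the images under `f` of an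
ultrafilter on `A` converge to a point `x` of `U`, then it converges to a point of `A` over `x`. -/
def ProperOver (f : Y → X) (A : Set Y) (U : Set X) : Prop :=
  ∀ 𝒰 : Ultrafilter Y, A ∈ 𝒰 → ∀ x ∈ U, Filter.Tendsto f 𝒰 (𝓝 x) → ∃ y ∈ A, f y = x ∧ ↑𝒰 ≤ 𝓝 y

namespace ProperOver

variable {A B : Set Y} {U V : Set X}

lemma empty (f : Y → X) (U : Set X) : ProperOver f ∅ U :=
  fun 𝒰 h ↦ (𝒰.empty_notMem h).elim

lemma union (hA : ProperOver f A U) (hB : ProperOver f B U) : ProperOver f (A ∪ B) U := by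
  intro 𝒰 h x hx hf
  rcases Ultrafilter.union_mem_iff.1 h with h | h
  · obtain ⟨y, hy, e⟩ := hA 𝒰 h x hx hf
    exact ⟨y, .inl hy, e⟩
  · obtain ⟨y, hy, e⟩ := hB 𝒰 h x hx hf
    exact ⟨y, .inr hy, e⟩

lemma mono (hA : ProperOver f A U) (hVU : V ⊆ U) : ProperOver f A V :=
  fun 𝒰 h x hx ↦ hA 𝒰 h x (hVU hx)

lemma inter_preimage (hA : ProperOver f A U) (hVU : V ⊆ U) : ProperOver f (A ∩ f ⁻¹' V) V := by
  intro 𝒰 h x hx hf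
  obtain ⟨y, hy, rfl, e⟩ := hA 𝒰 (Filter.mem_of_superset h Set.inter_subset_left) x (hVU hx) hf
  exact ⟨y, ⟨hy, hx⟩, rfl, e⟩

lemma of_subset (hA : ProperOver f A U) (hBA : B ⊆ A) (hB : ∀ y ∈ A, y ∈ closure B → y ∈ B) :
    ProperOver f B U := by
  intro 𝒰 h x hx hf
  obtain ⟨y, hy, e, hle⟩ := hA 𝒰 (Filter.mem_of_superset h hBA) x hx hf
  exact ⟨y, hB y hy (mem_closure_iff_ultrafilter.2 ⟨𝒰, h, hle⟩), e, hle⟩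

/-- An ultrafilter on `A` converging to `y` also converges to a point of `A` in the same fibre, and
separatedness forces the two limits to agree. -/
lemma mem_of_mem_closure (hA : ProperOver f A U) (hc : Continuous f) (hf : IsSeparatedMap f) {y : Y}
    (hyU : f y ∈ U) (hy : y ∈ closure A) : y ∈ A := by
  obtain ⟨𝒰, h, hle⟩ := mem_closure_iff_ultrafilter.1 hy
  obtain ⟨z, hz, e, hle'⟩ := hA 𝒰 h (f y) hyU ((hc.tendsto y).mono_left hle)
  by_contra hn
  have hd := isSeparatedMap_iff_disjoint_nhds.1 hf z y e (fun h ↦ hn (h ▸ hz))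
  exact 𝒰.neBot.ne (le_bot_iff.1 (hd hle' hle))

lemma isCompact_inter_fiber (hA : ProperOver f A U) {x : X} (hx : x ∈ U) :
    IsCompact (A ∩ f ⁻¹' {x}) := by
  rw [isCompact_iff_ultrafilter_le_nhds]
  intro 𝒰 h
  rw [Filter.le_principal_iff] at h
  obtain ⟨y, hy, e, hle⟩ := hA 𝒰 (Filter.mem_of_superset h Set.inter_subset_left) x hx
    (tendsto_const_nhds.congr' (Filter.mem_of_superset h fun z hz ↦ hz.2.symm))
  exact ⟨y, ⟨hy, e⟩, hle⟩

/-- A tube lemma: otherwise some ultrafilter on `A \ N` lies over `x` in the limit, and properness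
gives it a limit in `A ∩ f ⁻¹' {x} ⊆ N`, which is absurd as `N` is open. -/
lemma exists_nhds_subset (hA : ProperOver f A U) {x : X} (hx : x ∈ U) (hU : IsOpen U) {N : Set Y}
    (hN : IsOpen N) (h : A ∩ f ⁻¹' {x} ⊆ N) :
    ∃ V : Set X, IsOpen V ∧ x ∈ V ∧ V ⊆ U ∧ A ∩ f ⁻¹' V ⊆ N := by
  have hbot : Filter.comap f (𝓝 x) ⊓ Filter.principal (A \ N) = ⊥ := by
    by_contra hne
    have : (Filter.comap f (𝓝 x) ⊓ Filter.principal (A \ N)).NeBot := ⟨hne⟩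
    let 𝒱 := Ultrafilter.of (Filter.comap f (𝓝 x) ⊓ Filter.principal (A \ N))
    have h𝒱 := Ultrafilter.of_le (Filter.comap f (𝓝 x) ⊓ Filter.principal (A \ N))
    have hs : A \ N ∈ 𝒱 := Filter.le_principal_iff.1 (h𝒱.trans inf_le_right)
    obtain ⟨y, hy, e, hle⟩ := hA 𝒱 (Filter.mem_of_superset hs Set.sdiff_subset) x hx
      (Filter.tendsto_iff_comap.2 (h𝒱.trans inf_le_left))
    obtain ⟨z, hz, hz'⟩ := 𝒱.nonempty_of_mem
      (Filter.inter_mem hs (hle (hN.mem_nhds (h ⟨hy, e⟩))))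
    exact hz.2 hz'
  rw [← disjoint_iff, Filter.disjoint_principal_right, Filter.mem_comap] at hbot
  obtain ⟨T, hT, hTN⟩ := hbot
  obtain ⟨V, hVT, hV, hxV⟩ := mem_nhds_iff.1 hT
  refine ⟨V ∩ U, hV.inter hU, ⟨hxV, hx⟩, Set.inter_subset_right, fun y hy ↦ ?_⟩
  by_contra hn
  exact hTN (hVT hy.2.1) ⟨hy.1, hn⟩

end ProperOver

lemma IsProperMap.properOver {A : Set Y} {U : Set X} (h : Set.MapsTo f A U)
    (hp : IsProperMap (h.restrict f A U)) : ProperOver f A U := by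
  intro 𝒰 hA x hx hf
  have hr : Set.range (Subtype.val : A → Y) ∈ 𝒰 := by simpa using! hA
  let 𝒱 : Ultrafilter A := 𝒰.comap Subtype.val_injective hr
  have hmap : Filter.map Subtype.val (𝒱 : Filter A) = 𝒰 := by
    rw [Ultrafilter.coe_comap]; exact Filter.map_comap_of_mem hr
  obtain ⟨y, hy, hle⟩ := (isProperMap_iff_ultrafilter.1 hp).2 (𝒰 := 𝒱) (y := ⟨x, hx⟩) (by
    rw [tendsto_subtype_rng]
    change Filter.Tendsto (f ∘ Subtype.val) (𝒱 : Filter A) (𝓝 x)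
    rw [← Filter.tendsto_map'_iff, hmap]
    exact hf)
  refine ⟨y, y.2, congrArg Subtype.val hy, ?_⟩
  rw [← hmap]
  exact (Filter.map_mono hle).trans continuous_subtype_val.continuousAt

/-- Compact subsets of the fibers of a locally proper map have arbitrarily small proper
neighbourhoods. -/
lemma IsLocallyProper.exists_properOver (hf : IsLocallyProper f) {x : X} {K : Set Y}
    (hK : IsCompact K) (hKx : K ⊆ f ⁻¹' {x}) {V : Set Y} (hV : IsOpen V) (hKV : K ⊆ V) :
    ∃ (A : Set Y) (U : Set X), A ⊆ V ∧ IsOpen U ∧ x ∈ U ∧ A ⊆ f ⁻¹' U ∧ K ⊆ interior A ∧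
      ProperOver f A U := by
  -- The condition `A ⊆ f ⁻¹' U` is set aside because it is lost when `U` is shrunk in forming
  -- unions; intersecting with `f ⁻¹' U` at the end restores it.
  suffices h : ∃ (A : Set Y) (U : Set X), A ⊆ V ∧ IsOpen U ∧ x ∈ U ∧ K ⊆ interior A ∧
      ProperOver f A U by
    obtain ⟨A, U, hAV, hU, hx, hKA, hA⟩ := h
    refine ⟨A ∩ f ⁻¹' U, U, Set.inter_subset_left.trans hAV, hU, hx, Set.inter_subset_right, ?_,
      hA.inter_preimage le_rfl⟩
    rw [interior_inter, (hU.preimage hf.1).interior_eq]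
    refine Set.subset_inter hKA fun y hy ↦ ?_
    rw [Set.mem_preimage, show f y = x from hKx hy]
    exact hx
  refine hK.induction_on (p := fun S ↦ ∃ (A : Set Y) (U : Set X), A ⊆ V ∧ IsOpen U ∧ x ∈ U ∧
    S ⊆ interior A ∧ ProperOver f A U) ?_ ?_ ?_ ?_
  · exact ⟨∅, Set.univ, Set.empty_subset _, isOpen_univ, Set.mem_univ _, Set.empty_subset _,
      .empty f _⟩
  · rintro S T hST ⟨A, U, h₁, h₂, h₃, h₄, h₅⟩
    exact ⟨A, U, h₁, h₂, h₃, hST.trans h₄, h₅⟩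
  · rintro S T ⟨A, U, h₁, h₂, h₃, h₄, h₅⟩ ⟨A', U', h₁', h₂', h₃', h₄', h₅'⟩
    refine ⟨A ∪ A', U ∩ U', Set.union_subset h₁ h₁', h₂.inter h₂', ⟨h₃, h₃'⟩,
      Set.union_subset ?_ ?_,
      (h₅.mono Set.inter_subset_left).union (h₅'.mono Set.inter_subset_right)⟩
    · exact h₄.trans (interior_mono Set.subset_union_left)
    · exact h₄'.trans (interior_mono Set.subset_union_right)
  · intro y hy
    obtain ⟨A, hA, U, hU, hAV, h, hp⟩ := hf.2 y V (hV.mem_nhds (hKV hy))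
    rw [show f y = x from hKx hy] at hU
    exact ⟨interior A, mem_nhdsWithin_of_mem_nhds (interior_mem_nhds.2 hA), A, interior U, hAV,
      isOpen_interior, mem_interior_iff_mem_nhds.2 hU, le_rfl,
      (hp.properOver h).mono interior_subset⟩

/-- The fibers of a locally proper map are locally compact. -/
lemma IsLocallyProper.exists_isCompact_fiber_nhds (hf : IsLocallyProper f) {x : X} {y : Y}
    (hy : f y = x) {V : Set Y} (hV : V ∈ 𝓝 y) :
    ∃ L : Set Y, IsCompact L ∧ L ⊆ V ∧ L ⊆ f ⁻¹' {x} ∧ L ∈ 𝓝[f ⁻¹' {x}] y := by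
  obtain ⟨A, hA, U, hU, hAV, h, hp⟩ := hf.2 y V hV
  rw [hy] at hU
  exact ⟨A ∩ f ⁻¹' {x}, (hp.properOver h).isCompact_inter_fiber (mem_of_mem_nhds hU),
    Set.inter_subset_left.trans hAV, Set.inter_subset_right,
    Filter.inter_mem (mem_nhdsWithin_of_mem_nhds hA) self_mem_nhdsWithin⟩

end ProperOver

/-- In a fiber of a separated map, the intersection of two compact subsets is compact. -/
lemma IsSeparatedMap.isCompact_inter {Y X : Type*} [TopologicalSpace Y] {f : Y → X}
    (hf : IsSeparatedMap f) {x : X} {K L : Set Y} (hK : IsCompact K) (hL : IsCompact L)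
    (hKx : K ⊆ f ⁻¹' {x}) (hLx : L ⊆ f ⁻¹' {x}) : IsCompact (K ∩ L) := by
  rw [isCompact_iff_ultrafilter_le_nhds] at *
  intro 𝒰 h
  obtain ⟨y, hy, hle⟩ := hK 𝒰 (h.trans (Filter.principal_mono.2 Set.inter_subset_left))
  obtain ⟨z, hz, hle'⟩ := hL 𝒰 (h.trans (Filter.principal_mono.2 Set.inter_subset_right))
  have : y = z := by
    by_contra hn
    have hd := isSeparatedMap_iff_disjoint_nhds.1 hf y z ((hKx hy).trans (hLx hz).symm) hn
    exact 𝒰.neBot.ne (le_bot_iff.1 (hd hle hle'))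
  subst this
  exact ⟨y, ⟨hy, hz⟩, hle⟩

/-! ### Relatively soft sheaves -/

namespace Sh

variable {X Y Z : TopCat.{u}}

lemma mem_properSections_iff_properOver (f : Y ⟶ X) (F : Sh Y) (U : Opens X)
    (s : F.presheaf.obj (op ((Opens.map f).obj U))) :
    s ∈ properSections f F U ↔ ProperOver f (supp F s) U := by
  rw [mem_properSections, hasProperSupport_iff]
  constructor
  · intro h 𝒰 h𝒰 x hx hf
    obtain ⟨y, hy, e, hle⟩ := h 𝒰 h𝒰 x hx hf
    exact ⟨y, mem_of_supp_mem F s 𝒰 h𝒰 y hy hle, e, hle⟩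
  · intro h 𝒰 h𝒰 x hx hf
    obtain ⟨y, hy, e, hle⟩ := h 𝒰 h𝒰 x hx hf
    exact ⟨y, supp_subset F s hy, e, hle⟩

/-- The support is relatively closed in `f ⁻¹' U`, so it inherits properness from `A`. -/
lemma mem_properSections_of_supp_subset (f : Y ⟶ X) (F : Sh Y) (U : Opens X)
    (s : F.presheaf.obj (op ((Opens.map f).obj U))) {A : Set Y} (hA : ProperOver f A U)
    (hAU : A ⊆ f ⁻¹' U) (h : supp F s ⊆ A) : s ∈ properSections f F U := by
  rw [mem_properSections_iff_properOver]
  refine hA.of_subset h fun y hy hy' ↦ ?_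
  have := (isClosed_supp_union_compl F s).closure_subset_iff.2 Set.subset_union_left hy'
  exact this.resolve_right (fun hn ↦ hn (hAU hy))

lemma map_obj_mono (f : Y ⟶ X) {U V : Opens X} (h : V ≤ U) :
    (Opens.map f).obj V ≤ (Opens.map f).obj U :=
  fun _ hy ↦ h hy

lemma res_mem_properSections (f : Y ⟶ X) (F : Sh Y) {U V : Opens X} (h : V ≤ U)
    {s : F.presheaf.obj (op ((Opens.map f).obj U))} (hs : s ∈ properSections f F U) :
    res F (map_obj_mono f h) s ∈ properSections f F V :=
  map_mem_properSections f F (homOfLE h) hs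

lemma onSections_mem_properSections (f : Y ⟶ X) {F G : Sh Y} (φ : F ⟶ G) (U : Opens X)
    {s : F.presheaf.obj (op ((Opens.map f).obj U))} (hs : s ∈ properSections f F U) :
    onSections φ _ s ∈ properSections f G U :=
  app_mem_properSections f φ U hs

lemma supp_onSections_of_mono {F G : Sh Y} (φ : F ⟶ G) [Mono φ] {V : Opens Y}
    (s : F.presheaf.obj (op V)) : supp G (onSections φ V s) = supp F s := by
  refine (supp_onSections φ s).antisymm fun y hy ↦ ?_
  by_contra hn
  obtain ⟨W, hyW, h, h0⟩ := (notMem_supp_iff_res G _ (supp_subset F s hy)).1 hn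
  rw [← onSections_res] at h0
  refine (notMem_supp_iff_res F s (supp_subset F s hy)).2 ⟨W, hyW, h, ?_⟩ hy
  exact onSections_injective φ W (h0.trans (map_zero _).symm)

/-- A sheaf on `Y` is soft relatively to `f : Y ⟶ X` if every section on a neighbourhood of a
compact subset `K` of a fiber of `f` coincides near `K` with a section with proper support over
a neighbourhood of the base point of the fiber. -/
def IsRelSoft (f : Y ⟶ X) : ObjectProperty (Sh Y) := fun F ↦
  ∀ (x : X) (K : Set Y), IsCompact K → K ⊆ f ⁻¹' {x} → ∀ V : Opens Y, K ⊆ V →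
    ∀ s : F.presheaf.obj (op V), ∃ U : Opens X, x ∈ U ∧ ∃ t ∈ properSections f F U,
      ∃ W : Opens Y, K ⊆ W ∧ ∃ (h₁ : W ≤ V) (h₂ : W ≤ (Opens.map f).obj U),
        res F h₁ s = res F h₂ t

/-- With `A` a proper neighbourhood of `K`, the section equal to `s` over the interior of `A`, and
to zero off `supp s` and over the complement of the closure of `A`, extends to all of `g⁻¹(f⁻¹(U))`.
Its values over the rest of `A` are uncontrolled but harmless: its support stays in `supp s ∩
g⁻¹(A)`, which is proper over `U`. -/
lemma isRelSoft_properDirectImage (g : Z ⟶ Y) (f : Y ⟶ X) (hf : IsSeparatedMap f)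
    (hlp : IsLocallyProper f) (F : Sh Z)
    (hF : ∀ {V W : Opens Z} (h : W ≤ V), Function.Surjective (res F h)) :
    IsRelSoft f ((properDirectImage g).obj F) := by
  intro x K hK hKx V hKV s
  obtain ⟨s, hs⟩ : properSections g F V := s
  obtain ⟨A, U, hAV, hU, hx, hAU, hKA, hA⟩ := hlp.exists_properOver hK hKx V.isOpen hKV
  lift U to Opens X using hU
  let D : Opens Z := (Opens.map (g ≫ f)).obj U
  let I : Opens Y := ⟨interior A, isOpen_interior⟩
  let O₁ : Opens Z := (Opens.map g).obj I
  have hIV : I ≤ V := interior_subset.trans hAV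
  have hID : I ≤ (Opens.map f).obj U := interior_subset.trans hAU
  have hO₁V : O₁ ≤ (Opens.map g).obj V := map_obj_mono g hIV
  let O₂ : Opens Z := D ⊓ ((Opens.map g).obj ⟨(closure A)ᶜ, isClosed_closure.isOpen_compl⟩ ⊔
    ⟨_, (isClosed_supp_union_compl F s).isOpen_compl⟩)
  have hO₁D : O₁ ≤ D := map_obj_mono g hID
  have hO₂D : O₂ ≤ D := inf_le_left
  have h0 : res F (inf_le_left : O₁ ⊓ O₂ ≤ O₁) (res F hO₁V s) = 0 := by
    rw [res_res, res_eq_zero_iff, Set.disjoint_left]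
    rintro z hz ⟨hz₁, -, hz₂ | hz₂⟩
    · exact hz₂ (subset_closure (interior_subset hz₁))
    · exact hz₂ (.inl hz)
  obtain ⟨t₀, ht₁, ht₂⟩ := exists_glue₂ F (le_sup_left : O₁ ≤ O₁ ⊔ O₂) le_sup_right le_rfl
    (res F hO₁V s) 0 (by rw [h0, map_zero])
  obtain ⟨t, rfl⟩ := hF (sup_le hO₁D hO₂D) t₀
  rw [res_res] at ht₁ ht₂
  -- Limits are found in two stages: first in `A` by properness over `U`, then in `supp s` by
  -- properness over `V`, which contains `A`.
  have hC : ProperOver (g ≫ f) (supp F s ∩ g ⁻¹' A) U := by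
    intro 𝒰 h x hx hf
    obtain ⟨y, hy, e, hle⟩ := hA (𝒰.map g)
      (show g ⁻¹' A ∈ 𝒰 from Filter.mem_of_superset h Set.inter_subset_right) x hx
      (by rw [Ultrafilter.coe_map, Filter.tendsto_map'_iff]; exact hf)
    obtain ⟨z, hz, e', hle'⟩ := (mem_properSections_iff_properOver g F V s).1 hs 𝒰
      (Filter.mem_of_superset h Set.inter_subset_left) y (hAV hy) hle
    exact ⟨z, ⟨hz, by rwa [Set.mem_preimage, e']⟩, (congrArg f e').trans e, hle'⟩
  have ht : t ∈ properSections (g ≫ f) F U := by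
    refine mem_properSections_of_supp_subset (g ≫ f) F U t hC (fun z hz ↦ hAU hz.2) fun z hz ↦ ?_
    have hzD : z ∈ D := supp_subset F t hz
    by_contra hn
    refine Set.disjoint_left.1 ((res_eq_zero_iff F _ t).1 ht₂) hz ⟨hzD, ?_⟩
    by_cases hzA : g z ∈ closure A
    · have hzA' := hA.mem_of_mem_closure hlp.1 hf hzD hzA
      refine .inr fun h ↦ h.elim (fun h ↦ hn ⟨h, hzA'⟩) fun h ↦ h (hAV hzA')
    · exact .inl hzA
  exact ⟨U, hx, ⟨t, mem_properSections_left g f hf F U t ht⟩,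
    mem_properSections_right g f hf F U t ht, I, hKA, hIV, hID, Subtype.ext ht₁.symm⟩

/-- This is the previous lemma for `g = 𝟙 Y`, where every section has proper support. -/
lemma isRelSoft_of_res_surjective (f : Y ⟶ X) (hf : IsSeparatedMap f)
    (hlp : IsLocallyProper f) (F : Sh Y)
    (hF : ∀ {V W : Opens Y} (h : W ≤ V), Function.Surjective (res F h)) :
    IsRelSoft f F := by
  intro x K hK hKx V hKV s
  have hs : s ∈ properSections (𝟙 Y) F V :=
    (mem_properSections_iff_properOver (𝟙 Y) F V s).2 fun 𝒰 h y hy hle ↦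
      ⟨y, mem_of_supp_mem F s 𝒰 h y hy hle, rfl, hle⟩
  obtain ⟨U, hx, t, ht, W, hKW, h₁, h₂, e⟩ :=
    isRelSoft_properDirectImage (𝟙 Y) f hf hlp F hF x K hK hKx V hKV ⟨s, hs⟩
  exact ⟨U, hx, t.1, mem_properSections_comp_of_mem (𝟙 Y) f F U t ht, W, hKW, h₁, h₂,
    congrArg Subtype.val e⟩

/-! ### Short exact sequences with relatively soft kernel -/

section ShortExact

lemma onSections_g_f (S : ShortComplex (Sh Y)) {V : Opens Y} (s : S.X₁.presheaf.obj (op V)) :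
    onSections S.g V (onSections S.f V s) = 0 :=
  ConcreteCategory.congr_hom (congrArg (fun φ ↦ φ.1.app (op V)) S.zero) s

variable {f : Y ⟶ X} {S : ShortComplex (Sh Y)} (hS : S.ShortExact)
include hS

/-- If the kernel is relatively soft, sections of the cokernel lift near compact subsets of the
fibers. -/
lemma IsRelSoft.exists_lift (h₁ : IsRelSoft f S.X₁) (hf : IsSeparatedMap f)
    (hlp : IsLocallyProper f) {x : X} {K : Set Y} (hK : IsCompact K) (hKx : K ⊆ f ⁻¹' {x})
    {V : Opens Y} (hKV : K ⊆ V) (s : S.X₃.presheaf.obj (op V)) :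
    ∃ W : Opens Y, K ⊆ W ∧ ∃ (h : W ≤ V) (t : S.X₂.presheaf.obj (op W)),
      onSections S.g W t = res S.X₃ h s := by
  have hepi := (epi_iff_locally_surjective S.g).1 hS.epi_g
  -- Compact induction runs over arbitrary subsets of `K`; each is enclosed in a compact subset `L`
  -- of the fibre so that softness can be applied to the intersections.
  have key : ∃ L : Set Y, IsCompact L ∧ L ⊆ f ⁻¹' {x} ∧ K ⊆ L ∧ ∃ W : Opens Y, L ⊆ W ∧
      ∃ (h : W ≤ V) (t : S.X₂.presheaf.obj (op W)), onSections S.g W t = res S.X₃ h s := by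
    refine hK.induction_on (p := fun T ↦ ∃ L : Set Y, IsCompact L ∧ L ⊆ f ⁻¹' {x} ∧ T ⊆ L ∧
      ∃ W : Opens Y, L ⊆ W ∧ ∃ (h : W ≤ V) (t : S.X₂.presheaf.obj (op W)),
        onSections S.g W t = res S.X₃ h s) ?_ ?_ ?_ ?_
    · refine ⟨∅, isCompact_empty, Set.empty_subset _, le_rfl, ⊥, Set.empty_subset _, bot_le, 0, ?_⟩
      rw [map_zero, eq_comm, res_eq_zero_iff]
      exact Set.disjoint_empty _
    · rintro T T' hT ⟨L, hL, hLx, hTL, h⟩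
      exact ⟨L, hL, hLx, hT.trans hTL, h⟩
    · rintro T₁ T₂ ⟨L₁, hL₁, hLx₁, hTL₁, W₁, hLW₁, hWV₁, t₁, e₁⟩
        ⟨L₂, hL₂, hLx₂, hTL₂, W₂, hLW₂, hWV₂, t₂, e₂⟩
      obtain ⟨d, hd⟩ := exists_of_onSections_eq_zero hS
        (res S.X₂ (inf_le_left : W₁ ⊓ W₂ ≤ W₁) t₁ - res S.X₂ (inf_le_right : W₁ ⊓ W₂ ≤ W₂) t₂) (by
          rw [map_sub, onSections_res, onSections_res, e₁, e₂, res_res, res_res, sub_self])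
      -- The two lifts differ by a section `d` of the kernel. Near `L₁ ∩ L₂` it extends to `b`,
      -- defined on the preimage of a neighbourhood of `x`, so `t₁ - b` agrees there with `t₂`.
      obtain ⟨U, hx, b, -, W, hW, hW₁₂, hWU, hdb⟩ := h₁ x (L₁ ∩ L₂)
        (hf.isCompact_inter hL₁ hL₂ hLx₁ hLx₂) (Set.inter_subset_left.trans hLx₁) (W₁ ⊓ W₂)
        (Set.inter_subset_inter hLW₁ hLW₂) d
      obtain ⟨N, M, hN, hM, hLN, hLM, hNM⟩ :=
        hf.exists_open_inter_subset hL₁ hL₂ hLx₁ hLx₂ W.isOpen hW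
      let N' : Opens Y := ⟨N, hN⟩ ⊓ (W₁ ⊓ (Opens.map f).obj U)
      let M' : Opens Y := ⟨M, hM⟩ ⊓ W₂
      have hN'W₁ : N' ≤ W₁ := inf_le_right.trans inf_le_left
      have hN'U : N' ≤ (Opens.map f).obj U := inf_le_right.trans inf_le_right
      have hM'W₂ : M' ≤ W₂ := inf_le_right
      have hNMW : N' ⊓ M' ≤ W := fun y hy ↦ hNM ⟨hy.1.1, hy.2.1⟩
      obtain ⟨t, ht₁, ht₂⟩ := exists_glue₂ S.X₂ (le_sup_left : N' ≤ N' ⊔ M') le_sup_right le_rfl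
        (res S.X₂ hN'W₁ t₁ - onSections S.f _ (res S.X₁ hN'U b)) (res S.X₂ hM'W₂ t₂) (by
          have e := congrArg (fun c ↦ res S.X₂ hNMW (res S.X₂ hW₁₂ c)) hd
          have e' := congrArg (fun c ↦ onSections S.f _ (res S.X₁ hNMW c)) hdb
          simp only [map_sub, onSections_res, res_res] at e e' ⊢
          rw [e'] at e
          rw [e]
          abel)
      refine ⟨L₁ ∪ L₂, hL₁.union hL₂, Set.union_subset hLx₁ hLx₂,
        Set.union_subset_union hTL₁ hTL₂, N' ⊔ M', ?_, sup_le (hN'W₁.trans hWV₁)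
          (hM'W₂.trans hWV₂), t, ?_⟩
      · refine Set.union_subset_union (fun y hy ↦ ⟨hLN hy, hLW₁ hy, ?_⟩)
          (fun y hy ↦ ⟨hLM hy, hLW₂ hy⟩)
        change f y ∈ U
        rwa [show f y = x from hLx₁ hy]
      · refine section_ext₂ S.X₃ (le_sup_left : N' ≤ N' ⊔ M') le_sup_right le_rfl ?_ ?_
        · rw [← onSections_res, ht₁, map_sub, onSections_g_f S, sub_zero, onSections_res, e₁,
            res_res, res_res]
        · rw [← onSections_res, ht₂, onSections_res, e₂, res_res, res_res]
    · intro y hy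
      obtain ⟨W, hWV, hyW, t, ht⟩ := hepi V s y (hKV hy)
      obtain ⟨L, hL, hLW, hLx, hLy⟩ :=
        hlp.exists_isCompact_fiber_nhds (hKx hy) (W.isOpen.mem_nhds hyW)
      exact ⟨L, nhdsWithin_mono y hKx hLy, L, hL, hLx, le_rfl, W, hLW, hWV, t, ht⟩
  obtain ⟨L, -, -, hKL, W, hLW, h⟩ := key
  exact ⟨W, hKL.trans hLW, h⟩

/-- If the kernel is relatively soft, sections of the cokernel with proper support lift, locally on
the base, to sections with proper support. -/
lemma IsRelSoft.exists_lift_properSections (h₁ : IsRelSoft f S.X₁) (hf : IsSeparatedMap f)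
    (hlp : IsLocallyProper f) {U : Opens X}
    (s : S.X₃.presheaf.obj (op ((Opens.map f).obj U))) (hs : s ∈ properSections f S.X₃ U)
    {x : X} (hx : x ∈ U) :
    ∃ (U' : Opens X) (h : U' ≤ U), x ∈ U' ∧ ∃ t ∈ properSections f S.X₂ U',
      onSections S.g _ t = res S.X₃ (map_obj_mono f h) s := by
  rw [mem_properSections_iff_properOver] at hs
  obtain ⟨W, hKW, hWU, a, ha⟩ := h₁.exists_lift hS hf hlp (hs.isCompact_inter_fiber hx)
    Set.inter_subset_right (fun y hy ↦ supp_subset _ _ hy.1) s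
  obtain ⟨A, U₁, hAW, hU₁, hx₁, hAU₁, hKA, hA⟩ := hlp.exists_properOver
    (hs.isCompact_inter_fiber hx) Set.inter_subset_right W.isOpen hKW
  -- The part of `A` outside its interior is where the lift must be made to vanish. On its fibre
  -- over `x` the section `s` is zero, so near it `a` comes from a section `d` of the kernel.
  have hB : ProperOver f (A \ interior A) U₁ :=
    hA.of_subset Set.sdiff_subset fun y hy hy' ↦ ⟨hy,
      closure_minimal (fun z hz ↦ hz.2) isOpen_interior.isClosed_compl hy'⟩
  let V : Opens Y := W ⊓ ⟨_, (isClosed_supp_union_compl S.X₃ s).isOpen_compl⟩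
  have hVW : V ≤ W := inf_le_left
  obtain ⟨d, hd⟩ := exists_of_onSections_eq_zero hS (res S.X₂ hVW a) (by
    rw [onSections_res, ha, res_res, res_eq_zero_iff, Set.disjoint_left]
    exact fun y hy hy' ↦ hy'.2 (.inl hy))
  obtain ⟨U₂, hx₂, b, -, N, hBN, hNV, hNU₂, hdb⟩ := h₁ x _ (hB.isCompact_inter_fiber hx₁)
    Set.inter_subset_right V (fun y hy ↦ ⟨hAW hy.1.1, fun h ↦ h.elim
      (fun h ↦ hy.1.2 (hKA ⟨h, hy.2⟩)) (fun h ↦ h (hWU (hAW hy.1.1)))⟩) d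
  -- Shrinking the base puts `A \ interior A` inside `N`, where `d = b`, and, with `U₄`, puts the
  -- support of `s` inside the interior of `A`.
  obtain ⟨U₃, hU₃, hx₃, hU₃₁, hU₃N⟩ := hB.exists_nhds_subset hx₁ hU₁ N.isOpen hBN
  obtain ⟨U₄, hU₄, hx₄, hU₄U, hU₄A⟩ := hs.exists_nhds_subset hx U.isOpen isOpen_interior hKA
  lift U₃ to Opens X using hU₃
  lift U₄ to Opens X using hU₄
  let U' : Opens X := U₂ ⊓ (U₃ ⊓ U₄)
  have hU'U : U' ≤ U := fun y hy ↦ hU₄U hy.2.2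
  have hU'U₁ : (U' : Set X) ⊆ U₁ := fun y hy ↦ hU₃₁ hy.2.1
  let D : Opens Y := (Opens.map f).obj U'
  let O₁ : Opens Y := D ⊓ ⟨interior A, isOpen_interior⟩
  let O₂ : Opens Y := D ⊓ (N ⊔ ⟨(closure A)ᶜ, isClosed_closure.isOpen_compl⟩)
  have hO₁W : O₁ ≤ W := fun y hy ↦ hAW (interior_subset hy.2)
  have hO₁U₂ : O₁ ≤ (Opens.map f).obj U₂ := fun y hy ↦ hy.1.1
  have hO₁D : O₁ ≤ D := inf_le_left
  have hO₂D : O₂ ≤ D := inf_le_left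
  have hD : D ≤ O₁ ⊔ O₂ := by
    intro y hy
    by_cases hyA : y ∈ closure A
    · have hyA' := hA.mem_of_mem_closure hlp.1 hf (hU'U₁ hy) hyA
      by_cases hyI : y ∈ interior A
      · exact .inl ⟨hy, hyI⟩
      · exact .inr ⟨hy, .inl (hU₃N ⟨⟨hyA', hyI⟩, hy.2.1⟩)⟩
    · exact .inr ⟨hy, .inr hyA⟩
  have hON : O₁ ⊓ O₂ ≤ N := fun y hy ↦
    hy.2.2.resolve_right fun h ↦ h (subset_closure (interior_subset hy.1.2))
  -- The overlap lies in `N`, where `a - b` vanishes, so it glues with zero. On `O₁` subtracting `b`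
  -- does not change the image in the cokernel; on `O₂` the section `s` is itself zero.
  obtain ⟨t, ht₁, ht₂⟩ := exists_glue₂ S.X₂ hO₁D hO₂D hD
    (res S.X₂ hO₁W a - onSections S.f _ (res S.X₁ hO₁U₂ b)) 0 (by
      have e := congrArg (fun c ↦ res S.X₂ hON (res S.X₂ hNV c)) hd
      have e' := congrArg (fun c ↦ onSections S.f _ (res S.X₁ hON c)) hdb
      simp only [map_sub, onSections_res, res_res, map_zero] at e e' ⊢
      rw [← e, e', sub_self])
  refine ⟨U', hU'U, ⟨hx₂, hx₃, hx₄⟩, t, ?_, ?_⟩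
  · refine mem_properSections_of_supp_subset f S.X₂ U' t (hA.inter_preimage hU'U₁)
      Set.inter_subset_right fun y hy ↦ ?_
    have hyD : y ∈ D := supp_subset S.X₂ t hy
    rcases hD hyD with h | h
    · exact ⟨interior_subset h.2, hyD⟩
    · exact (Set.disjoint_left.1 ((res_eq_zero_iff S.X₂ _ t).1 ht₂) hy h).elim
  · refine section_ext₂ S.X₃ hO₁D hO₂D hD ?_ ?_
    · rw [← onSections_res, ht₁, map_sub, onSections_g_f S, sub_zero, onSections_res, ha,
        res_res, res_res]
    · rw [← onSections_res, ht₂, map_zero, eq_comm, res_res, res_eq_zero_iff, Set.disjoint_left]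
      rintro y hy ⟨hyD, hy' | hy'⟩
      · exact (hNV hy').2 (.inl hy)
      · exact hy' (subset_closure (interior_subset (hU₄A ⟨hy, hyD.2.2⟩)))

/-- Softness of the kernel lifts the section near `K`, softness of the middle term extends the lift,
and the image of the extension is as required. -/
lemma IsRelSoft.quotient (h₁ : IsRelSoft f S.X₁) (h₂ : IsRelSoft f S.X₂) (hf : IsSeparatedMap f)
    (hlp : IsLocallyProper f) : IsRelSoft f S.X₃ := by
  intro x K hK hKx V hKV s
  obtain ⟨V', hKV', hV', a, ha⟩ := h₁.exists_lift hS hf hlp hK hKx hKV s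
  obtain ⟨U, hx, t, ht, W, hKW, hWV', hWU, e⟩ := h₂ x K hK hKx V' hKV' a
  refine ⟨U, hx, onSections S.g _ t, onSections_mem_properSections f S.g U ht, W, hKW,
    hWV'.trans hV', hWU, ?_⟩
  rw [← onSections_res, ← e, onSections_res, ha, res_res]

/-- Left exactness holds because a monomorphism preserves supports; softness of the kernel enters
only in the surjectivity, which may be checked locally on the base. -/
lemma IsRelSoft.shortExact_map (h₁ : IsRelSoft f S.X₁) (hf : IsSeparatedMap f)
    (hlp : IsLocallyProper f) : (S.map (properDirectImage f)).ShortExact where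
  exact := by
    have := hS.mono_f
    refine exact_of_onSections _ fun U s hs ↦ ?_
    obtain ⟨s, hs'⟩ : properSections f S.X₂ U := s
    obtain ⟨t, rfl⟩ := exists_of_onSections_eq_zero hS s (congrArg Subtype.val hs)
    refine ⟨⟨t, ?_⟩, rfl⟩
    rw [mem_properSections_iff_properOver] at hs' ⊢
    rwa [supp_onSections_of_mono] at hs'
  mono_f := by
    have := hS.mono_f
    refine mono_of_onSections_injective _ fun U s t h ↦ Subtype.ext ?_
    exact onSections_injective S.f _ (congrArg Subtype.val h)
  epi_g := by
    refine (epi_iff_locally_surjective _).2 fun U s x hx ↦ ?_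
    obtain ⟨U', h, hx', t, ht, e⟩ := h₁.exists_lift_properSections hS hf hlp s.1 s.2 hx
    exact ⟨U', h, hx', ⟨t, ht⟩, Subtype.ext e⟩

end ShortExact

/-- The two components of a section are extended separately and added; for a biproduct the `total`
identity is all that this needs. -/
lemma IsRelSoft.of_total {f : Y ⟶ X} {F G H : Sh Y} (hF : IsRelSoft f F) (hG : IsRelSoft f G)
    (p : H ⟶ F) (q : H ⟶ G) (i : F ⟶ H) (j : G ⟶ H) (total : p ≫ i + q ≫ j = 𝟙 H) :
    IsRelSoft f H := by
  intro x K hK hKx V hKV s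
  obtain ⟨U₁, hx₁, t₁, ht₁, W₁, hKW₁, hWV₁, hWU₁, e₁⟩ := hF x K hK hKx V hKV
    (onSections p V s)
  obtain ⟨U₂, hx₂, t₂, ht₂, W₂, hKW₂, hWV₂, hWU₂, e₂⟩ := hG x K hK hKx V hKV
    (onSections q V s)
  have hWU : W₁ ⊓ W₂ ≤ (Opens.map f).obj (U₁ ⊓ U₂) := fun y hy ↦ ⟨hWU₁ hy.1, hWU₂ hy.2⟩
  refine ⟨U₁ ⊓ U₂, ⟨hx₁, hx₂⟩,
    onSections i _ (res F (map_obj_mono f inf_le_left) t₁) +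
      onSections j _ (res G (map_obj_mono f inf_le_right) t₂),
    add_mem (onSections_mem_properSections f _ _ (res_mem_properSections f F inf_le_left ht₁))
      (onSections_mem_properSections f _ _ (res_mem_properSections f G inf_le_right ht₂)),
    W₁ ⊓ W₂, Set.subset_inter hKW₁ hKW₂, inf_le_left.trans hWV₁, hWU, ?_⟩
  have e : s = onSections i V (onSections p V s) +
      onSections j V (onSections q V s) :=
    (ConcreteCategory.congr_hom (congrArg (fun φ ↦ φ.1.app (op V)) total) s).symm
  replace e₁ := congrArg (res F (inf_le_left : W₁ ⊓ W₂ ≤ W₁)) e₁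
  replace e₂ := congrArg (res G (inf_le_right : W₁ ⊓ W₂ ≤ W₂)) e₂
  rw [res_res, res_res] at e₁ e₂
  rw [map_add, ← onSections_res, ← onSections_res, res_res, res_res, ← e₁, ← e₂, onSections_res,
    onSections_res, ← map_add, ← e]

lemma isAdapted_isRelSoft (f : Y ⟶ X) (hf : IsSeparatedMap f) (hlp : IsLocallyProper f) :
    DerivedPlus.IsAdapted (IsRelSoft f) (properDirectImage f) where
  injective F hF := isRelSoft_of_res_surjective f hf hlp F (res_surjective_of_injective F hF)
  biprod _ _ h₁ h₂ := h₁.of_total h₂ _ _ _ _ Limits.biprod.total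
  shortExact_map _ hS h₁ := h₁.shortExact_map hS hf hlp
  quotient _ hS h₁ h₂ := h₁.quotient hS h₂ hf hlp

end Sh

theorem theoremt {X Y Z : TopCat.{u}}
    [HasDerivedCategory.{w₁} (Sh Z)] [HasDerivedCategory.{w₂} (Sh Y)]
    [HasDerivedCategory.{w₃} (Sh X)]
    (g : Z ⟶ Y) (f : Y ⟶ X)
    (hg_sep : IsSeparatedMap g) (hg_lp : IsLocallyProper g)
    (hf_sep : IsSeparatedMap f) (hf_lp : IsLocallyProper f) :
    (Sh.derivedProperDirectImage (g ≫ f)).IsTriangulated ∧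
    (Sh.derivedProperDirectImage g ⋙ Sh.derivedProperDirectImage f).IsTriangulated ∧
    NatTrans.CommShift (Sh.derivedProperDirectImageComparison g f hf_sep) ℤ ∧
    IsIso (Sh.derivedProperDirectImageComparison g f hf_sep) :=
  ⟨inferInstance, inferInstance, DerivedPlus.commShift_rightDerivedComparison _,
    DerivedPlus.isIso_rightDerivedComparison _ _ (Sh.isAdapted_isRelSoft f hf_sep hf_lp)
      fun F hF ↦ Sh.isRelSoft_properDirectImage g f hf_sep hf_lp F
        (Sh.res_surjective_of_injective F hF)⟩
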